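/- **Theorem (uniform consistency under the hypergraph stochastic block model).** Fix integers $M\ge 2$ and $K\ge 1$ and a real number $C_1\ge 1$. There is a constant $C>0$, depending only on $M$, $K$ and $C_1$, such that the following holds. *Model.* For every $n$ let $\boldsymbol u^*=\boldsymbol u^*_n\in\mathbb R^n$ be a utility vector with $\sum_{k}u^*_k=0$ and $\|\boldsymbol u^*\|_\infty\le\log C_1$, let $[n]=V_1\sqcup\cdots\sqcup V_K$ be a partition (depending on $n$), and let $\omega_{n,0},\dots,\omega_{n,K}\in[0,1]$. Let $E_n$ be the random $M$-uniform hypergraph on $[n]$ in which the $M$-subsets $e$ of $[n]$ are edges independently of each other, with probability $\omega_{n,i}$ if $e\subseteq V_i$ for some $i\in[K]$, and $\omega_{n,0}$ if $e$ is contained in no block. Conditionally on $E_n$, the edges carry independent rankings $\pi_e$ that follow the Plackett–Luce model: a bijection $\pi:\{1,\dots,M\}\to e$ (with $\pi(j)$ the object of rank $j$) is observed with probability $\prod_{j=1}^{M}e^{u^*_{\pi(j)}}\big/\sum_{t=j}^{M}e^{u^*_{\pi(t)}}$. The data for all $n$ live on one probability space; their joint law across different $n$ is arbitrary. Given the edge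 set, let $y_e\in\{1,\dots,M\}$ ($e\in E_n$) be prescribed numbers (of observed top positions), which may depend on $n$ and $E_n$. *Estimators.* The marginal MLE $\widehat{\boldsymbol u}$ and the QMLE $\widetilde{\boldsymbol u}$ are the maximizers over $\{\boldsymbol u\in\mathbb R^n:\sum_k u_k=0\}$ of, respectively, $$l_1(\boldsymbol u)=\sum_{e\in E_n}\sum_{j=1}^{y_e}\Big[u_{\pi_e(j)}-\log\sum_{t=j}^{M}e^{u_{\pi_e(t)}}\Big],\qquad l_2(\boldsymbol u)=\sum_{e\in E_n}\ \sum_{1\le j<t\le M}\Big[u_{\pi_e(j)}-\log\big(e^{u_{\pi_e(j)}}+e^{u_{\pi_e(t)}}\big)\Big].$$ *Assumption.* Let $\zeta_{n,-}:=n^{M-1}\min_{0\le i\le K}\omega_{n,i}$; suppose that $\zeta_{n,-}>0$ for all large $n$ and $(\log n)^3/\zeta_{n,-}\to0$. *Conclusion.* Almost surely, for all sufficiently large $n$, both $\widehat{\boldsymbol u}$ and $\widetilde{\boldsymbol u}$ exist and are unique, and for $\boldsymbol w=\widehat{\boldsymbol u}$ and $\boldsymbol w=\widetilde{\boldsymbol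 u}$ $$\|\boldsymbol w-\boldsymbol u^*\|_\infty\le C\sqrt{\frac{(\log n)^3}{\zeta_{n,-}}},\qquad\text{where }\sqrt{\frac{(\log n)^3}{\zeta_{n,-}}}\to0\text{ as }n\to\infty.$$ -/

import Mathlib

open MeasureTheory ProbabilityTheory Filter Topology

noncomputable section

/-- A full ranking of the comparison set `e`: the bijection `j ↦ π(j)` that sends a position
(`0` is the top one) to the object of `e` in that position. -/
abbrev Ranking {n : ℕ} (e : Finset (Fin n)) : Type := Fin e.card ≃ e

/-- The Plackett--Luce probability of the ranking `π` of `e` under the utility vector `u`: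
`∏ⱼ exp(u_{π(j)}) / ∑_{t ≥ j} exp(u_{π(t)})`. -/
def plMass {n : ℕ} (u : Fin n → ℝ) {e : Finset (Fin n)} (π : Ranking e) : ℝ :=
  ∏ j, Real.exp (u (π j)) / ∑ t ∈ Finset.Ici j, Real.exp (u (π t))

/-- `E` is an `M`-uniform hypergraph stochastic block model on `n` vertices. The labelling `c`
describes the partition of the vertices into the `K` blocks `V_i = {v | c v = i}`; the possible
edges (the `M`-subsets) are present independently of each other, with probability `ω i.succ` if
the edge lies in `V_i` and with probability `ω 0` if it lies in no block. -/
structure IsHSBM {Ω : Type*} [MeasurableSpace Ω] (P : Measure Ω) (M : ℕ) {K n : ℕ}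
    (c : Fin n → Fin K) (ω : Fin (K + 1) → ℝ) (E : Ω → Finset (Finset (Fin n))) : Prop where
  measurableSet_eq : ∀ F, MeasurableSet {x | E x = F}
  uniform : ∀ x, ∀ e ∈ E x, e.card = M
  indep : iIndepSet (fun e : {e : Finset (Fin n) // e.card = M} => {x | e.1 ∈ E x}) P
  prob_within : ∀ (i : Fin K) (e : Finset (Fin n)), e.card = M → (∀ v ∈ e, c v = i) →
    P.real {x | e ∈ E x} = ω i.succ
  prob_across : ∀ e : Finset (Fin n), e.card = M → (∀ i : Fin K, ¬ ∀ v ∈ e, c v = i) →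
    P.real {x | e ∈ E x} = ω 0

/-- Conditionally on the edge set, the rankings of the edges are independent, and each follows the
Plackett--Luce model with utility vector `u`. The value of `π` at a set that is not an edge
plays no role. -/
structure IsPLData {Ω : Type*} [MeasurableSpace Ω] (P : Measure Ω) {n : ℕ} (u : Fin n → ℝ)
    (E : Ω → Finset (Finset (Fin n))) (π : Ω → (e : Finset (Fin n)) → Ranking e) : Prop where
  measurableSet_ranking : ∀ (e : Finset (Fin n)) (σ : Ranking e),
    MeasurableSet {x | e ∈ E x ∧ π x e = σ}
  law : ∀ (F : Finset (Finset (Fin n))) (σ : (e : Finset (Fin n)) → Ranking e),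
    P.real {x | E x = F ∧ ∀ e ∈ F, π x e = σ e} =
      P.real {x | E x = F} * ∏ e ∈ F, plMass u (σ e)

/-- The marginal log-likelihood based on the top `y e` objects of the ranking of each edge `e`. -/
def marginalLogLik {n : ℕ} (E : Finset (Finset (Fin n))) (π : (e : Finset (Fin n)) → Ranking e)
    (y : Finset (Fin n) → ℕ) (u : Fin n → ℝ) : ℝ :=
  ∑ e ∈ E, ∑ j : Fin e.card with j.val < y e,
    (u (π e j) - Real.log (∑ t ∈ Finset.Ici j, Real.exp (u (π e t))))

/-- The log-quasi-likelihood obtained from the full breaking of every ranking into pairwise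
comparisons. -/
def quasiLogLik {n : ℕ} (E : Finset (Finset (Fin n))) (π : (e : Finset (Fin n)) → Ranking e)
    (u : Fin n → ℝ) : ℝ :=
  ∑ e ∈ E, ∑ j : Fin e.card, ∑ t ∈ Finset.Ioi j,
    (u (π e j) - Real.log (Real.exp (u (π e j)) + Real.exp (u (π e t))))

/-- `v` maximizes `l` subject to the identifiability constraint `∑ k, v k = 0`. -/
def IsConstrainedMax {n : ℕ} (l : (Fin n → ℝ) → ℝ) (v : Fin n → ℝ) : Prop :=
  ∑ k, v k = 0 ∧ ∀ v' : Fin n → ℝ, ∑ k, v' k = 0 → l v' ≤ l v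

/-- `ζ_{n,-} = n^{M-1} min_{0 ≤ i ≤ K} ω_i`. -/
def zetaMinus (M n : ℕ) {K : ℕ} (ω : Fin (K + 1) → ℝ) : ℝ :=
  (n : ℝ) ^ (M - 1) * Finset.univ.inf' Finset.univ_nonempty ω

/-- The rate `sqrt((log n)^3 / ζ_{n,-})`. -/
def hsbmRate (M n : ℕ) {K : ℕ} (ω : Fin (K + 1) → ℝ) : ℝ :=
  Real.sqrt (Real.log n ^ 3 / zetaMinus M n ω)

end

/-! Both log-likelihoods are sums of Luce choices made on the edges, and `ChoiceModel` treats them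
together. The main object is the score of a vertex set `U`, the derivative of the log-likelihood in
the direction of the indicator of `U`. It vanishes at a maximizer `v`. At the truth `u` it is a sum
of centred terms, one for each edge that crosses `U`.

Let `δ = v - u`, let `U` be an upper level set `{δ ≥ t}` with at most half of the vertices, and let
`N` be the number of edges crossing `U`. Passing from `u` to `v` lowers the contribution of every
edge to the score, and lowers it by at least a constant times `D` when the edge crosses `U` with no
vertex in the layer `t - D ≤ δ < t`. Conditionally on the graph, Hoeffding's inequality bounds the
score at `u` by a multiple of `√(N |U| log n)`. Since `N ≥ z |U|`, where `z` is of order `ζ`, this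
is at most a multiple of `N √(log n / z)`. With `D` a suitable multiple of `√(log n / z)`, at least
half of the crossing edges therefore meet the layer (`ChoiceModel.cut_le_of_score`).

The layer must then carry a large volume. Ordinary volume is not comparable with the cut: a dense
block with sparse links to the others has a huge volume and a small boundary. So volumes are kept
separately for each pair of blocks, and for each pair the smaller of the volumes of `U` and of its
complement is at most a constant times `N` (`min_blockVol_le`, then `consistency_of_regular`). Hence
at each level one of the `K²` volumes grows by a fixed fraction of its distance to the ends of its
range, which a logarithmic potential allows only `O(log n)` times (`card_steps_le`). After `T =
O(log n)` levels, more than half of the vertices are within `T D` of the maximum of `δ`. By symmetry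
more than half are within `T D` of the minimum, so the two sets meet, and since `δ` sums to zero,
`|δ| ≤ 2 T D`. This has order `log n · √(log n / z)`, the claimed rate.

The same score estimate shows that no set wins all its comparisons, which gives existence; strict
monotonicity of the score gives uniqueness (`ChoiceModel.exists_unique_and_close`). Chernoff bounds
and union bounds over vertex sets make the required events fail with probability `O(n⁻²)`, and the
Borel–Cantelli lemma concludes. -/

/-! ### Centred statistics of Plackett–Luce rankings. -/

/-- The Plackett--Luce probability of the order `σ` of `Fin m` under the weights `w`. -/
noncomputable def permMass {m : ℕ} (w : Fin m → ℝ) (σ : Equiv.Perm (Fin m)) : ℝ :=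
  ∏ j, w (σ j) / ∑ t ∈ Finset.Ici j, w (σ t)

/-- The values of `w` at the objects that remain once `p` has been ranked first. -/
def tailWeights {m : ℕ} (w : Fin (m + 1) → ℝ) (p : Fin (m + 1)) (i : Fin m) : ℝ :=
  w (Equiv.swap 0 p i.succ)

lemma decomposeFin_symm_succ {m : ℕ} (w : Fin (m + 1) → ℝ) (p : Fin (m + 1))
    (σ : Equiv.Perm (Fin m)) (i : Fin m) :
    w (Equiv.Perm.decomposeFin.symm (p, σ) i.succ) = tailWeights w p (σ i) := by
  rw [Equiv.Perm.decomposeFin_symm_apply_succ]; rfl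

lemma sum_Ici_succ {m : ℕ} (g : Fin (m + 1) → ℝ) (i : Fin m) :
    ∑ t ∈ Finset.Ici i.succ, g t = ∑ t ∈ Finset.Ici i, g t.succ := by
  rw [← Fin.map_succEmb_Ici, Finset.sum_map]; rfl

lemma sum_Ioi_succ {m : ℕ} (g : Fin (m + 1) → ℝ) (i : Fin m) :
    ∑ t ∈ Finset.Ioi i.succ, g t = ∑ t ∈ Finset.Ioi i, g t.succ := by
  rw [← Fin.map_succEmb_Ioi, Finset.sum_map]; rfl

lemma sum_Ici_zero {m : ℕ} (g : Fin (m + 1) → ℝ) :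
    ∑ t ∈ Finset.Ici 0, g t = ∑ t, g t := by
  congr 1; ext t; simp

lemma sum_Ioi_zero {m : ℕ} (g : Fin (m + 1) → ℝ) :
    ∑ t ∈ Finset.Ioi 0, g t = ∑ t : Fin m, g t.succ := by
  have h : (Finset.Ioi (0 : Fin (m + 1))) = Finset.univ.map (Fin.succEmb m) := by
    ext t
    refine Fin.cases ?_ (fun i => ?_) t <;> simp
  rw [h, Finset.sum_map]; rfl

/-- The model is sequential: the top object is a Luce choice, and the rest is again a Plackett–Luce
ranking. All the expectations below are inductions on this factorization. -/
lemma permMass_decompose {m : ℕ} (w : Fin (m + 1) → ℝ) (p : Fin (m + 1))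
    (σ : Equiv.Perm (Fin m)) :
    permMass w (Equiv.Perm.decomposeFin.symm (p, σ)) =
      w p / (∑ t, w t) * permMass (tailWeights w p) σ := by
  unfold permMass
  rw [Fin.prod_univ_succ, sum_Ici_zero, Equiv.sum_comp _ w,
    Equiv.Perm.decomposeFin_symm_apply_zero]
  congr 1
  refine Finset.prod_congr rfl fun i _ => ?_
  rw [sum_Ici_succ (fun t => w (Equiv.Perm.decomposeFin.symm (p, σ) t))]
  simp only [decomposeFin_symm_succ]

lemma sum_perm_succ {m : ℕ} (F : Equiv.Perm (Fin (m + 1)) → ℝ) :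
    ∑ σ, F σ = ∑ p, ∑ σ : Equiv.Perm (Fin m), F (Equiv.Perm.decomposeFin.symm (p, σ)) := by
  rw [← Equiv.sum_comp (Equiv.Perm.decomposeFin (n := m)).symm F, Fintype.sum_prod_type]

lemma sum_permMass {m : ℕ} (w : Fin m → ℝ) (hw : ∀ i, 0 < w i) : ∑ σ, permMass w σ = 1 := by
  induction m with
  | zero => simp [permMass]
  | succ m ih =>
    rw [sum_perm_succ]
    have hs : 0 < ∑ t, w t := Finset.sum_pos (fun i _ => hw i) Finset.univ_nonempty
    simp only [permMass_decompose, ← Finset.mul_sum]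
    simp only [ih (tailWeights w _) (fun i => hw _), mul_one]
    rw [← Finset.sum_div, div_self hs.ne']

/-- The indicator-type statistic of the choice made at position `j` is centred under the
Plackett--Luce model. -/
lemma sum_permMass_mul_choice {m : ℕ} (w f : Fin m → ℝ) (hw : ∀ i, 0 < w i) (j : Fin m) :
    ∑ σ, permMass w σ * (f (σ j) -
      (∑ t ∈ Finset.Ici j, w (σ t) * f (σ t)) / ∑ t ∈ Finset.Ici j, w (σ t)) = 0 := by
  induction m with
  | zero => exact j.elim0
  | succ m ih =>
    rw [sum_perm_succ]
    have hs : 0 < ∑ t, w t := Finset.sum_pos (fun i _ => hw i) Finset.univ_nonempty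
    refine Fin.cases ?_ (fun i => ?_) j
    · simp only [permMass_decompose, sum_Ici_zero, Equiv.Perm.decomposeFin_symm_apply_zero,
        Equiv.sum_comp _ w, Equiv.sum_comp _ (fun t => w t * f t)]
      have : ∀ p, ∑ σ, w p / (∑ t, w t) * permMass (tailWeights w p) σ *
          (f p - (∑ t, w t * f t) / ∑ t, w t) =
          w p / (∑ t, w t) * (f p - (∑ t, w t * f t) / ∑ t, w t) := by
        intro p
        rw [← Finset.sum_mul, ← Finset.mul_sum,
          sum_permMass (tailWeights w p) (fun i => hw _), mul_one]
      simp only [this]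
      simp only [mul_sub, Finset.sum_sub_distrib, ← Finset.sum_mul, ← Finset.sum_div,
        div_self hs.ne', one_mul]
      rw [sub_eq_zero, Finset.sum_div]
      exact Finset.sum_congr rfl fun p _ => by ring
    · refine Finset.sum_eq_zero fun p _ => ?_
      have h := ih (tailWeights w p) (tailWeights f p) (fun i => hw _) i
      have h2 : ∀ σ : Equiv.Perm (Fin m),
          permMass w (Equiv.Perm.decomposeFin.symm (p, σ)) *
          (f (Equiv.Perm.decomposeFin.symm (p, σ) i.succ) -
            (∑ t ∈ Finset.Ici i.succ, w (Equiv.Perm.decomposeFin.symm (p, σ) t) *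
              f (Equiv.Perm.decomposeFin.symm (p, σ) t)) /
            ∑ t ∈ Finset.Ici i.succ, w (Equiv.Perm.decomposeFin.symm (p, σ) t)) =
          w p / (∑ t, w t) * (permMass (tailWeights w p) σ * (tailWeights f p (σ i) -
          (∑ t ∈ Finset.Ici i, tailWeights w p (σ t) * tailWeights f p (σ t)) /
            ∑ t ∈ Finset.Ici i, tailWeights w p (σ t))) := by
        intro σ
        rw [sum_Ici_succ (fun t => w (Equiv.Perm.decomposeFin.symm (p, σ) t)),
          sum_Ici_succ (fun t => w (Equiv.Perm.decomposeFin.symm (p, σ) t) *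
              f (Equiv.Perm.decomposeFin.symm (p, σ) t)), permMass_decompose]
        simp only [decomposeFin_symm_succ]
        ring
      simp only [h2, ← Finset.mul_sum, h, mul_zero]

/-- The comparisons of the first object with all the others do not depend on how those are ordered;
the vanishing diagonal allows `p` itself to join the sum. -/
lemma sum_sum_succ_swap {m : ℕ} (g : Fin (m + 1) → Fin (m + 1) → ℝ) (p : Fin (m + 1))
    (hg : g p p = 0) (σ : Equiv.Perm (Fin m)) :
    ∑ t : Fin m, g p (Equiv.Perm.decomposeFin.symm (p, σ) t.succ) = ∑ b, g p b := by
  rw [← Equiv.sum_comp (Equiv.Perm.decomposeFin.symm (p, σ)) (g p), Fin.sum_univ_succ,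
    Equiv.Perm.decomposeFin_symm_apply_zero, hg, zero_add]

/-- The statistic of all the pairwise comparisons in a ranking is centred under the
Plackett--Luce model. -/
lemma sum_permMass_mul_pairs {m : ℕ} (w f : Fin m → ℝ) (hw : ∀ i, 0 < w i) :
    ∑ σ, permMass w σ * ∑ j, ∑ t ∈ Finset.Ioi j, (f (σ j) -
      (w (σ j) * f (σ j) + w (σ t) * f (σ t)) / (w (σ j) + w (σ t))) = 0 := by
  induction m with
  | zero => simp
  | succ m ih =>
    rw [sum_perm_succ]
    set g : Fin (m + 1) → Fin (m + 1) → ℝ :=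
      fun a b => f a - (w a * f a + w b * f b) / (w a + w b) with hg
    have hgp : ∀ a b, g a b = w b * (f a - f b) / (w a + w b) := by
      intro a b
      have : w a + w b ≠ 0 := (add_pos (hw a) (hw b)).ne'
      simp only [hg]; field_simp; ring
    have hgd : ∀ p, g p p = 0 := fun p => by rw [hgp]; simp
    have hs : 0 < ∑ t, w t := Finset.sum_pos (fun i _ => hw i) Finset.univ_nonempty
    -- Separate the comparisons won by the first object from those among the remaining ones, which
    -- the induction hypothesis handles.
    have key : ∀ (p : Fin (m + 1)) (σ : Equiv.Perm (Fin m)),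
        permMass w (Equiv.Perm.decomposeFin.symm (p, σ)) * ∑ j, ∑ t ∈ Finset.Ioi j,
          g (Equiv.Perm.decomposeFin.symm (p, σ) j) (Equiv.Perm.decomposeFin.symm (p, σ) t) =
        w p / (∑ t, w t) * (permMass (tailWeights w p) σ * ∑ b, g p b) +
        w p / (∑ t, w t) * (permMass (tailWeights w p) σ * ∑ j, ∑ t ∈ Finset.Ioi j,
          (tailWeights f p (σ j) - (tailWeights w p (σ j) * tailWeights f p (σ j) +
            tailWeights w p (σ t) * tailWeights f p (σ t)) /
            (tailWeights w p (σ j) + tailWeights w p (σ t)))) := by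
      intro p σ
      rw [Fin.sum_univ_succ, sum_Ioi_zero, Equiv.Perm.decomposeFin_symm_apply_zero,
        sum_sum_succ_swap g p (hgd p), permMass_decompose]
      have : ∀ j : Fin m, ∑ t ∈ Finset.Ioi j.succ,
          g (Equiv.Perm.decomposeFin.symm (p, σ) j.succ)
            (Equiv.Perm.decomposeFin.symm (p, σ) t) = ∑ t ∈ Finset.Ioi j,
          (tailWeights f p (σ j) - (tailWeights w p (σ j) * tailWeights f p (σ j) +
            tailWeights w p (σ t) * tailWeights f p (σ t)) /
            (tailWeights w p (σ j) + tailWeights w p (σ t))) := by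
        intro j
        rw [sum_Ioi_succ (fun t => g (Equiv.Perm.decomposeFin.symm (p, σ) j.succ)
            (Equiv.Perm.decomposeFin.symm (p, σ) t))]
        simp only [hg, decomposeFin_symm_succ]
      simp only [this]
      ring
    -- The chance that `p` comes first is proportional to `w p`, and `w p * g p b` is antisymmetric,
    -- so the comparisons won by the first object cancel in pairs.
    have hanti : ∑ p, w p * ∑ b, g p b = 0 := by
      have h1 : ∀ p b, w p * g p b = - (w b * g b p) := by
        intro p b
        rw [hgp, hgp, add_comm (w b)]
        ring
      have h2 : ∑ p, w p * ∑ b, g p b = - ∑ p, w p * ∑ b, g p b := by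
        simp only [Finset.mul_sum]
        conv_lhs => rw [Finset.sum_comm]
        rw [← Finset.sum_neg_distrib]
        refine Finset.sum_congr rfl fun p _ => ?_
        rw [← Finset.sum_neg_distrib]
        exact Finset.sum_congr rfl fun b _ => h1 b p
      linarith
    change ∑ p, ∑ σ : Equiv.Perm (Fin m),
        permMass w (Equiv.Perm.decomposeFin.symm (p, σ)) * ∑ j, ∑ t ∈ Finset.Ioi j,
          g (Equiv.Perm.decomposeFin.symm (p, σ) j) (Equiv.Perm.decomposeFin.symm (p, σ) t) = 0
    simp only [key, Finset.sum_add_distrib, ← Finset.mul_sum, ← Finset.sum_mul]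
    simp only [ih (tailWeights w _) (tailWeights f _) (fun i => hw _),
      sum_permMass (tailWeights w _) (fun i => hw _)]
    have : ∑ i, w i / (∑ t, w t) * (1 * ∑ b, g i b) =
        (∑ i, w i * ∑ b, g i b) / ∑ t, w t := by
      rw [Finset.sum_div]
      exact Finset.sum_congr rfl fun p _ => by ring
    rw [this, hanti]
    simp

/-- The identification of the rankings of `e` with the permutations of the positions. -/
noncomputable def rankingEquivPerm {n : ℕ} (e : Finset (Fin n)) :
    Ranking e ≃ Equiv.Perm (Fin e.card) :=
  Equiv.equivCongr (Equiv.refl _) e.equivFin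

lemma sum_plMass_mul {n : ℕ} (u : Fin n → ℝ) (e : Finset (Fin n)) (F : Ranking e → ℝ) :
    ∑ π, plMass u π * F π =
      ∑ σ, permMass (fun i => Real.exp (u (e.equivFin.symm i))) σ *
        F ((rankingEquivPerm e).symm σ) := by
  rw [← Equiv.sum_comp (rankingEquivPerm e).symm]
  rfl

lemma plMass_nonneg {n : ℕ} (u : Fin n → ℝ) {e : Finset (Fin n)} (π : Ranking e) :
    0 ≤ plMass u π := by
  unfold plMass; positivity

lemma sum_plMass {n : ℕ} (u : Fin n → ℝ) (e : Finset (Fin n)) :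
    ∑ π : Ranking e, plMass u π = 1 := by
  have := sum_plMass_mul u e (fun _ => 1)
  simp only [mul_one] at this
  rw [this, sum_permMass _ (fun i => Real.exp_pos _)]

lemma sum_plMass_mul_choice {n : ℕ} (u : Fin n → ℝ) (e : Finset (Fin n)) (f : Fin n → ℝ)
    (j : Fin e.card) :
    ∑ π : Ranking e, plMass u π * (f (π j) -
      (∑ t ∈ Finset.Ici j, Real.exp (u (π t)) * f (π t)) /
        ∑ t ∈ Finset.Ici j, Real.exp (u (π t))) = 0 := by
  rw [sum_plMass_mul u e (fun π => f (π j) -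
      (∑ t ∈ Finset.Ici j, Real.exp (u (π t)) * f (π t)) /
        ∑ t ∈ Finset.Ici j, Real.exp (u (π t)))]
  exact sum_permMass_mul_choice _ (fun i => f (e.equivFin.symm i)) (fun i => Real.exp_pos _) j

lemma sum_plMass_mul_pairs {n : ℕ} (u : Fin n → ℝ) (e : Finset (Fin n)) (f : Fin n → ℝ) :
    ∑ π : Ranking e, plMass u π * ∑ j, ∑ t ∈ Finset.Ioi j, (f (π j) -
      (Real.exp (u (π j)) * f (π j) + Real.exp (u (π t)) * f (π t)) /
        (Real.exp (u (π j)) + Real.exp (u (π t)))) = 0 := by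
  rw [sum_plMass_mul u e (fun π => ∑ j, ∑ t ∈ Finset.Ioi j, (f (π j) -
      (Real.exp (u (π j)) * f (π j) + Real.exp (u (π t)) * f (π t)) /
        (Real.exp (u (π j)) + Real.exp (u (π t)))))]
  exact sum_permMass_mul_pairs _ (fun i => f (e.equivFin.symm i)) (fun i => Real.exp_pos _)

/-! ### Edge cuts and Luce choice probabilities. -/

/-- The edge `e` has a vertex in `U` and a vertex outside of `U`. -/
abbrev Crosses {V : Type*} (e U : Finset V) : Prop := (∃ x ∈ e, x ∈ U) ∧ ∃ x ∈ e, x ∉ U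

/-- The edges of `E` that cross `U`. -/
def edgeCut {V : Type*} [DecidableEq V] (E : Finset (Finset V)) (U : Finset V) :
    Finset (Finset V) := {e ∈ E | Crosses e U}

lemma edgeCut_subset {V : Type*} [DecidableEq V] (E : Finset (Finset V)) (U : Finset V) :
    edgeCut E U ⊆ E := Finset.filter_subset _ _

lemma crosses_compl {V : Type*} [Fintype V] [DecidableEq V] {e U : Finset V} :
    Crosses e Uᶜ ↔ Crosses e U := by
  simp only [Crosses, Finset.mem_compl, not_not]; exact and_comm

lemma edgeCut_compl {V : Type*} [Fintype V] [DecidableEq V] (E : Finset (Finset V))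
    (U : Finset V) : edgeCut E Uᶜ = edgeCut E U := by
  unfold edgeCut; exact Finset.filter_congr fun e _ => crosses_compl

section SoftMass

variable {V : Type*} [DecidableEq V]

/-- The probability that an object of `U` is chosen from `A` under Luce's choice model. -/
noncomputable def softMass (u : V → ℝ) (A U : Finset V) : ℝ :=
  (∑ b ∈ A with b ∈ U, Real.exp (u b)) / ∑ b ∈ A, Real.exp (u b)

lemma softMass_eq (u : V → ℝ) (A U : Finset V) :
    softMass u A U = (∑ b ∈ A with b ∈ U, Real.exp (u b)) /
      ((∑ b ∈ A with b ∈ U, Real.exp (u b)) + ∑ b ∈ A with b ∉ U, Real.exp (u b)) := by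
  rw [softMass, Finset.sum_filter_add_sum_filter_not]

lemma softMass_nonneg (u : V → ℝ) (A U : Finset V) : 0 ≤ softMass u A U :=
  div_nonneg (Finset.sum_nonneg fun _ _ => (Real.exp_pos _).le)
    (Finset.sum_nonneg fun _ _ => (Real.exp_pos _).le)

lemma softMass_le_one (u : V → ℝ) (A U : Finset V) : softMass u A U ≤ 1 :=
  div_le_one_of_le₀ (Finset.sum_le_sum_of_subset_of_nonneg (Finset.filter_subset _ _)
    fun _ _ _ => (Real.exp_pos _).le) (Finset.sum_nonneg fun _ _ => (Real.exp_pos _).le)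

lemma softMass_of_subset (u : V → ℝ) {A U : Finset V} (hA : A.Nonempty) (h : A ⊆ U) :
    softMass u A U = 1 := by
  rw [softMass, Finset.filter_true_of_mem fun x hx => h hx]
  exact div_self (Finset.sum_pos (fun _ _ => Real.exp_pos _) hA).ne'

lemma softMass_of_disjoint (u : V → ℝ) {A U : Finset V} (h : ∀ x ∈ A, x ∉ U) :
    softMass u A U = 0 := by
  rw [softMass, Finset.filter_false_of_mem h]; simp

lemma softMass_compl [Fintype V] (u : V → ℝ) {A : Finset V} (U : Finset V) (hA : A.Nonempty) :
    softMass u A Uᶜ = 1 - softMass u A U := by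
  have h := (Finset.sum_pos (fun b _ => Real.exp_pos (u b)) hA).ne'
  rw [softMass, softMass, eq_sub_iff_add_eq, ← add_div, div_eq_one_iff_eq h]
  simp only [Finset.mem_compl]
  rw [add_comm, Finset.sum_filter_add_sum_filter_not]

lemma odds_mass_lt {P Q P' Q' t D : ℝ} (hP : 0 < P) (hQ : 0 < Q) (hQ0 : 0 < Q')
    (hP' : Real.exp t * P ≤ P') (hQ' : Q' ≤ Real.exp (t - D) * Q) (hD : 0 < D) :
    P / (P + Q) < P' / (P' + Q') := by
  have hP0 : 0 < P' := lt_of_lt_of_le (by positivity) hP'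
  rw [div_lt_div_iff₀ (by positivity) (by positivity)]
  have h1 : P * Q' ≤ P * (Real.exp (t - D) * Q) := by gcongr
  have h2 : Real.exp t * P * Q ≤ P' * Q := by gcongr
  have h3 : Real.exp (t - D) < Real.exp t := Real.exp_lt_exp.2 (by linarith)
  have h4 : Real.exp (t - D) * (P * Q) < Real.exp t * (P * Q) := by gcongr
  nlinarith

/-- The hypotheses multiply the odds of `P` against `Q` by at least `exp D`. Replacing `P` by `exp D
* P` changes the proportion by an explicit amount; `D ≤ 1` gives `exp D ≤ 3`, hence the constant. -/
lemma odds_mass_gap {P Q P' Q' t D : ℝ} (hP : 0 < P) (hQ : 0 < Q) (hQ0 : 0 < Q')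
    (hP' : Real.exp t * P ≤ P') (hQ' : Q' ≤ Real.exp (t - D) * Q) (hD : 0 ≤ D) (hD1 : D ≤ 1) :
    P / (P + Q) + D * (P * Q) / (3 * (P + Q) ^ 2) ≤ P' / (P' + Q') := by
  have hP0 : 0 < P' := lt_of_lt_of_le (by positivity) hP'
  set d := Real.exp D with hd
  have hd1 : D + 1 ≤ d := Real.add_one_le_exp D
  have hd3 : d ≤ 3 := (Real.exp_le_exp.2 hD1).trans (by linarith [Real.exp_one_lt_d9])
  have hd0 : 0 < d := Real.exp_pos _
  have step1 : d * P / (d * P + Q) ≤ P' / (P' + Q') := by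
    rw [div_le_div_iff₀ (by positivity) (by positivity)]
    have e1 : Real.exp t = d * Real.exp (t - D) := by rw [hd, ← Real.exp_add]; ring_nf
    have h1 : d * P * Q' ≤ d * P * (Real.exp (t - D) * Q) := by gcongr
    have h2 : Real.exp t * P * Q ≤ P' * Q := by gcongr
    rw [e1] at h2
    nlinarith
  refine le_trans ?_ step1
  have e2 : d * P / (d * P + Q) = P / (P + Q) + (d - 1) * (P * Q) / ((d * P + Q) * (P + Q)) := by
    have : d * P + Q ≠ 0 := by positivity
    have : P + Q ≠ 0 := by positivity
    field_simp; ring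
  rw [e2]
  have : D * (P * Q) / (3 * (P + Q) ^ 2) ≤ (d - 1) * (P * Q) / ((d * P + Q) * (P + Q)) := by
    have hd' : 0 ≤ d - 1 := by linarith
    rw [show 3 * (P + Q) ^ 2 = (3 * (P + Q)) * (P + Q) by ring]
    gcongr
    · linarith
    · nlinarith
  linarith

variable {u v : V → ℝ} {A U : Finset V} {t D : ℝ}

lemma exp_mul_sum_le_of_le (hU : ∀ x ∈ A, x ∈ U → t ≤ v x - u x) :
    Real.exp t * ∑ b ∈ A with b ∈ U, Real.exp (u b) ≤ ∑ b ∈ A with b ∈ U, Real.exp (v b) := by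
  rw [Finset.mul_sum]
  refine Finset.sum_le_sum fun b hb => ?_
  rw [Finset.mem_filter] at hb
  rw [← Real.exp_add, Real.exp_le_exp]
  linarith [hU b hb.1 hb.2]

lemma sum_le_exp_mul_of_le (hU : ∀ x ∈ A, x ∉ U → v x - u x ≤ t) :
    ∑ b ∈ A with b ∉ U, Real.exp (v b) ≤ Real.exp t * ∑ b ∈ A with b ∉ U, Real.exp (u b) := by
  rw [Finset.mul_sum]
  refine Finset.sum_le_sum fun b hb => ?_
  rw [Finset.mem_filter] at hb
  rw [← Real.exp_add, Real.exp_le_exp]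
  linarith [hU b hb.1 hb.2]

lemma sum_exp_pos_of_crosses (u : V → ℝ) (hA : Crosses A U) :
    0 < ∑ b ∈ A with b ∈ U, Real.exp (u b) ∧ 0 < ∑ b ∈ A with b ∉ U, Real.exp (u b) := by
  obtain ⟨⟨x, hx, hxU⟩, y, hy, hyU⟩ := hA
  exact ⟨Finset.sum_pos (fun _ _ => Real.exp_pos _) ⟨x, by simp [hx, hxU]⟩,
    Finset.sum_pos (fun _ _ => Real.exp_pos _) ⟨y, by simp [hy, hyU]⟩⟩

lemma softMass_lt_of_gap (hA : Crosses A U) (hU : ∀ x ∈ A, x ∈ U → t ≤ v x - u x)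
    (hU' : ∀ x ∈ A, x ∉ U → v x - u x ≤ t - D) (hD : 0 < D) :
    softMass u A U < softMass v A U := by
  rw [softMass_eq, softMass_eq]
  exact odds_mass_lt (sum_exp_pos_of_crosses u hA).1 (sum_exp_pos_of_crosses u hA).2
    (sum_exp_pos_of_crosses v hA).2 (exp_mul_sum_le_of_le hU) (sum_le_exp_mul_of_le hU') hD

lemma softMass_eq_of_not_crosses (hA : A.Nonempty) (h : ¬ Crosses A U) :
    softMass u A U = softMass v A U := by
  by_cases h1 : ∃ x ∈ A, x ∈ U
  · have h2 : A ⊆ U := fun x hx => by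
      by_contra hxU
      exact h ⟨h1, x, hx, hxU⟩
    rw [softMass_of_subset u hA h2, softMass_of_subset v hA h2]
  · push Not at h1
    rw [softMass_of_disjoint u h1, softMass_of_disjoint v h1]

lemma sum_exp_bounds {L : ℝ} (hL : ∀ x, |u x| ≤ L) (hA : Crosses A U) :
    Real.exp (-L) ≤ ∑ b ∈ A with b ∈ U, Real.exp (u b) ∧
    Real.exp (-L) ≤ ∑ b ∈ A with b ∉ U, Real.exp (u b) ∧
    (∑ b ∈ A with b ∈ U, Real.exp (u b)) + ∑ b ∈ A with b ∉ U, Real.exp (u b) ≤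
      A.card * Real.exp L := by
  obtain ⟨⟨x, hx, hxU⟩, y, hy, hyU⟩ := hA
  refine ⟨?_, ?_, ?_⟩
  · refine le_trans (Real.exp_le_exp.2 (neg_le_of_abs_le (hL x)))
      (Finset.single_le_sum (f := fun b => Real.exp (u b)) (fun _ _ => (Real.exp_pos _).le) ?_)
    simp [hx, hxU]
  · refine le_trans (Real.exp_le_exp.2 (neg_le_of_abs_le (hL y)))
      (Finset.single_le_sum (f := fun b => Real.exp (u b)) (fun _ _ => (Real.exp_pos _).le) ?_)
    simp [hy, hyU]
  · rw [Finset.sum_filter_add_sum_filter_not, ← nsmul_eq_mul]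
    exact Finset.sum_le_card_nsmul _ _ _ fun b _ => Real.exp_le_exp.2 (le_of_abs_le (hL b))

/-- Quantitative monotonicity of the choice probability. The constant comes from `P * Q ≥ exp (-2 *
L)` and `(P + Q) ^ 2 ≤ m ^ 2 * exp (2 * L)` in `odds_mass_gap`. -/
lemma softMass_add_le_of_gap {L m : ℝ} (hL : ∀ x, |u x| ≤ L) (hm : (A.card : ℝ) ≤ m)
    (hA : Crosses A U) (hU : ∀ x ∈ A, x ∈ U → t ≤ v x - u x)
    (hU' : ∀ x ∈ A, x ∉ U → v x - u x ≤ t - D) (hD : 0 ≤ D) (hD1 : D ≤ 1) :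
    softMass u A U + Real.exp (-4 * L) / (3 * m ^ 2) * D ≤ softMass v A U := by
  rw [softMass_eq, softMass_eq]
  refine le_trans ?_ (odds_mass_gap (sum_exp_pos_of_crosses u hA).1
    (sum_exp_pos_of_crosses u hA).2 (sum_exp_pos_of_crosses v hA).2 (exp_mul_sum_le_of_le hU)
    (sum_le_exp_mul_of_le hU') hD hD1)
  obtain ⟨h1, h2, h3⟩ := sum_exp_bounds hL hA
  have hP := (sum_exp_pos_of_crosses u hA).1
  have hQ := (sum_exp_pos_of_crosses u hA).2
  set P := ∑ b ∈ A with b ∈ U, Real.exp (u b)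
  set Q := ∑ b ∈ A with b ∉ U, Real.exp (u b)
  have h4 : P + Q ≤ m * Real.exp L := h3.trans (by gcongr)
  have hm0 : 0 < m := by
    by_contra h
    have : m * Real.exp L ≤ 0 := mul_nonpos_of_nonpos_of_nonneg (not_lt.1 h) (Real.exp_pos _).le
    linarith
  have key : Real.exp (-4 * L) / (3 * m ^ 2) * D ≤ D * (P * Q) / (3 * (P + Q) ^ 2) := by
    have e1 : Real.exp (-4 * L) / (3 * m ^ 2) * D =
        D * (Real.exp (-L) * Real.exp (-L)) / (3 * (m * Real.exp L) ^ 2) := by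
      have : Real.exp (-4 * L) = (Real.exp L)⁻¹ ^ 4 := by
        rw [← Real.exp_neg, ← Real.exp_nat_mul]; push_cast; ring_nf
      rw [this, Real.exp_neg]
      have := Real.exp_pos L
      field_simp
    rw [e1]
    gcongr
  linarith

lemma one_sub_softMass_ge {L m : ℝ} (hL : ∀ x, |u x| ≤ L) (hm : (A.card : ℝ) ≤ m)
    (hA : Crosses A U) : Real.exp (-2 * L) / m ≤ 1 - softMass u A U := by
  obtain ⟨h1, h2, h3⟩ := sum_exp_bounds hL hA
  have hP := (sum_exp_pos_of_crosses u hA).1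
  have hQ := (sum_exp_pos_of_crosses u hA).2
  rw [softMass_eq]
  set P := ∑ b ∈ A with b ∈ U, Real.exp (u b)
  set Q := ∑ b ∈ A with b ∉ U, Real.exp (u b)
  have h4 : P + Q ≤ m * Real.exp L := h3.trans (by gcongr)
  have e1 : 1 - P / (P + Q) = Q / (P + Q) := by
    have : P + Q ≠ 0 := by positivity
    field_simp; ring
  have e2 : Real.exp (-2 * L) / m = Real.exp (-L) / (m * Real.exp L) := by
    have : Real.exp (-2 * L) = Real.exp (-L) * (Real.exp L)⁻¹ := by
      rw [← Real.exp_neg, ← Real.exp_add]; ring_nf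
    rw [this, mul_comm m, ← div_div, div_eq_mul_inv (Real.exp (-L))]
  rw [e1, e2]
  gcongr

end SoftMass

/-! ### Choice models: scores, uniqueness and existence of maximizers. -/

/-- A family of choices observed on the edges of `E`: at the `i`-th choice on the edge `e`,
the object `chosen e i` is selected from the set `set e i`. -/
structure ChoiceModel {V : Type*} [DecidableEq V] (E : Finset (Finset V)) where
  κ : Finset V → Type
  terms : ∀ e, Finset (κ e)
  set : ∀ e, κ e → Finset V
  chosen : ∀ e, κ e → V
  chosen_mem : ∀ e ∈ E, ∀ i ∈ terms e, chosen e i ∈ set e i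
  set_subset : ∀ e ∈ E, ∀ i ∈ terms e, set e i ⊆ e
  exists_crosses : ∀ e ∈ E, ∀ U, Crosses e U → ∃ i ∈ terms e, Crosses (set e i) U

namespace ChoiceModel

variable {V : Type*} [DecidableEq V] {E : Finset (Finset V)} (S : ChoiceModel E)

/-- The log-likelihood of the choices under Luce's choice model. -/
noncomputable def logLik (u : V → ℝ) : ℝ :=
  ∑ e ∈ E, ∑ i ∈ S.terms e, (u (S.chosen e i) - Real.log (∑ b ∈ S.set e i, Real.exp (u b)))

/-- The contribution of the edge `e` to the derivative of the log-likelihood in the direction of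
the indicator of `U`. -/
noncomputable def edgeScore (U : Finset V) (u : V → ℝ) (e : Finset V) : ℝ :=
  ∑ i ∈ S.terms e, ((if S.chosen e i ∈ U then 1 else 0) - softMass u (S.set e i) U)

/-- The derivative of the log-likelihood in the direction of the indicator of `U`. -/
noncomputable def score (U : Finset V) (u : V → ℝ) : ℝ := ∑ e ∈ E, S.edgeScore U u e

lemma set_nonempty {e : Finset V} (he : e ∈ E) {i : S.κ e} (hi : i ∈ S.terms e) :
    (S.set e i).Nonempty := ⟨_, S.chosen_mem e he i hi⟩

lemma logLik_add_const (u : V → ℝ) (s : ℝ) : S.logLik (fun x => u x + s) = S.logLik u := by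
  unfold logLik
  refine Finset.sum_congr rfl fun e he => Finset.sum_congr rfl fun i hi => ?_
  have hpos := Finset.sum_pos (fun b _ => Real.exp_pos (u b)) (S.set_nonempty he hi)
  simp only [Real.exp_add, ← Finset.sum_mul]
  rw [Real.log_mul hpos.ne' (Real.exp_pos s).ne', Real.log_exp]
  ring

lemma hasDerivAt_logLik (u : V → ℝ) (U : Finset V) :
    HasDerivAt (fun s : ℝ => S.logLik (fun x => u x + s * (if x ∈ U then 1 else 0)))
      (S.score U u) 0 := by
  unfold logLik score edgeScore
  refine HasDerivAt.fun_sum fun e he => HasDerivAt.fun_sum fun i hi => ?_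
  have hlin : ∀ x : V, HasDerivAt (fun s : ℝ => u x + s * (if x ∈ U then 1 else 0))
      (if x ∈ U then 1 else 0) 0 := by
    intro x
    simpa using ((hasDerivAt_id (0 : ℝ)).mul_const (if x ∈ U then (1 : ℝ) else 0)).const_add (u x)
  have hpos := Finset.sum_pos (fun b _ => Real.exp_pos (u b)) (S.set_nonempty he hi)
  refine (hlin _).sub ?_
  have hsum : HasDerivAt (fun s : ℝ => ∑ b ∈ S.set e i,
      Real.exp (u b + s * (if b ∈ U then 1 else 0)))
      (∑ b ∈ S.set e i, Real.exp (u b + 0 * (if b ∈ U then 1 else 0)) *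
        (if b ∈ U then 1 else 0)) 0 :=
    HasDerivAt.fun_sum fun b _ => (hlin b).exp
  have := hsum.log (by simpa using hpos.ne')
  refine this.congr_deriv ?_
  simp [softMass, Finset.sum_filter]

lemma score_eq_zero_of_forall_le {v : V → ℝ} (hv : ∀ v', S.logLik v' ≤ S.logLik v)
    (U : Finset V) : S.score U v = 0 := by
  refine IsLocalMax.hasDerivAt_eq_zero (Filter.Eventually.of_forall fun s => ?_)
    (S.hasDerivAt_logLik v U)
  simpa using hv _

lemma edgeScore_compl [Fintype V] (U : Finset V) (u : V → ℝ) {e : Finset V} (he : e ∈ E) :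
    S.edgeScore Uᶜ u e = - S.edgeScore U u e := by
  unfold edgeScore
  rw [← Finset.sum_neg_distrib]
  refine Finset.sum_congr rfl fun i hi => ?_
  rw [softMass_compl u U (S.set_nonempty he hi)]
  by_cases h : S.chosen e i ∈ U <;> simp [h]

lemma score_compl [Fintype V] (U : Finset V) (u : V → ℝ) : S.score Uᶜ u = - S.score U u := by
  unfold score
  rw [← Finset.sum_neg_distrib]
  exact Finset.sum_congr rfl fun e he => S.edgeScore_compl U u he

lemma not_crosses_set {U e : Finset V} (he : e ∈ E) (h : ¬ Crosses e U) {i : S.κ e}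
    (hi : i ∈ S.terms e) : ¬ Crosses (S.set e i) U := fun ⟨⟨x, hx, hxU⟩, y, hy, hyU⟩ =>
  h ⟨⟨x, S.set_subset e he i hi hx, hxU⟩, y, S.set_subset e he i hi hy, hyU⟩

variable {u v : V → ℝ} {U : Finset V} {t D : ℝ}

lemma softMass_le_of_le {A : Finset V} (hA : A.Nonempty) (hU : ∀ x ∈ A, x ∈ U → t ≤ v x - u x)
    (hU' : ∀ x ∈ A, x ∉ U → v x - u x ≤ t) : softMass u A U ≤ softMass v A U := by
  by_cases h : Crosses A U
  · rw [softMass_eq, softMass_eq]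
    have := odds_mass_gap (D := 0) (sum_exp_pos_of_crosses u h).1
      (sum_exp_pos_of_crosses u h).2 (sum_exp_pos_of_crosses v h).2 (exp_mul_sum_le_of_le hU)
      (by simpa using sum_le_exp_mul_of_le hU') le_rfl zero_le_one
    simpa using this
  · exact (softMass_eq_of_not_crosses hA h).le

/-- The chosen objects do not depend on the utilities, so only the choice probabilities of `U` vary,
and these increase when `v - u` is larger on `U` than off it. -/
lemma edgeScore_le_of_le {e : Finset V} (he : e ∈ E) (hU : ∀ x ∈ e, x ∈ U → t ≤ v x - u x)
    (hU' : ∀ x ∈ e, x ∉ U → v x - u x ≤ t) : S.edgeScore U v e ≤ S.edgeScore U u e :=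
  Finset.sum_le_sum fun i hi => sub_le_sub_left (softMass_le_of_le (S.set_nonempty he hi)
    (fun x hx => hU x (S.set_subset e he i hi hx))
    (fun x hx => hU' x (S.set_subset e he i hi hx))) _

lemma edgeScore_lt_of_gap {e : Finset V} (he : e ∈ E) (hc : Crosses e U)
    (hU : ∀ x ∈ e, x ∈ U → t ≤ v x - u x) (hU' : ∀ x ∈ e, x ∉ U → v x - u x ≤ t - D)
    (hD : 0 < D) : S.edgeScore U v e < S.edgeScore U u e := by
  obtain ⟨i, hi, hic⟩ := S.exists_crosses e he U hc
  refine Finset.sum_lt_sum (fun i hi => sub_le_sub_left (softMass_le_of_le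
    (S.set_nonempty he hi) (fun x hx => hU x (S.set_subset e he i hi hx))
    (fun x hx hxU => (hU' x (S.set_subset e he i hi hx) hxU).trans (by linarith))) _)
    ⟨i, hi, sub_lt_sub_left (softMass_lt_of_gap hic
      (fun x hx => hU x (S.set_subset e he i hi hx))
      (fun x hx => hU' x (S.set_subset e he i hi hx)) hD) _⟩

lemma edgeScore_add_le_of_gap {L m : ℝ} (hL : ∀ x, |u x| ≤ L) {e : Finset V} (he : e ∈ E)
    (hm : (e.card : ℝ) ≤ m) (hc : Crosses e U)
    (hU : ∀ x ∈ e, x ∈ U → t ≤ v x - u x) (hU' : ∀ x ∈ e, x ∉ U → v x - u x ≤ t - D)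
    (hD : 0 ≤ D) (hD1 : D ≤ 1) :
    S.edgeScore U v e + Real.exp (-4 * L) / (3 * m ^ 2) * D ≤ S.edgeScore U u e := by
  obtain ⟨i, hi, hic⟩ := S.exists_crosses e he U hc
  rw [← le_sub_iff_add_le', edgeScore, edgeScore, ← Finset.sum_sub_distrib]
  have hcard : ((S.set e i).card : ℝ) ≤ m :=
    le_trans (by exact_mod_cast Finset.card_le_card (S.set_subset e he i hi)) hm
  have h1 := softMass_add_le_of_gap hL hcard hic (fun x hx => hU x (S.set_subset e he i hi hx))
    (fun x hx => hU' x (S.set_subset e he i hi hx)) hD hD1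
  refine le_trans ?_ (Finset.single_le_sum (fun i hi => ?_) hi)
  · linarith
  · have := softMass_le_of_le (S.set_nonempty he hi)
      (fun x hx => hU x (S.set_subset e he i hi hx))
      (fun x hx hxU => (hU' x (S.set_subset e he i hi hx) hxU).trans (sub_le_self t hD))
    linarith

/-- When `U` wins every mixed choice, no term is negative, and a mixed choice contributes the
probability that the complement had of winning it. This is what rules out divergence of the
estimator. -/
lemma edgeScore_ge_of_wins {L m : ℝ} (hL : ∀ x, |u x| ≤ L) {e : Finset V} (he : e ∈ E)
    (hm : (e.card : ℝ) ≤ m) (hc : Crosses e U)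
    (hw : ∀ i ∈ S.terms e, Crosses (S.set e i) U → S.chosen e i ∈ U) :
    Real.exp (-2 * L) / m ≤ S.edgeScore U u e := by
  obtain ⟨i, hi, hic⟩ := S.exists_crosses e he U hc
  have hcard : ((S.set e i).card : ℝ) ≤ m :=
    le_trans (by exact_mod_cast Finset.card_le_card (S.set_subset e he i hi)) hm
  have h1 := one_sub_softMass_ge hL hcard hic
  unfold edgeScore
  refine le_trans ?_ (Finset.single_le_sum (fun i hi => ?_) hi)
  · simpa [hw i hi hic] using h1
  · by_cases h : S.chosen e i ∈ U
    · simpa [h] using softMass_le_one u _ U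
    · have : ¬ Crosses (S.set e i) U := fun hcr => h (hw i hi hcr)
      have h2 : ∀ x ∈ S.set e i, x ∉ U := fun x hx hxU =>
        this ⟨⟨x, hx, hxU⟩, _, S.chosen_mem e he i hi, h⟩
      simp [h, softMass_of_disjoint u h2]

lemma edgeScore_eq_zero_of_not_crosses {e : Finset V} (he : e ∈ E) (h : ¬ Crosses e U) :
    S.edgeScore U u e = 0 := by
  refine Finset.sum_eq_zero fun i hi => ?_
  have hn := S.not_crosses_set he h hi
  by_cases hx : S.chosen e i ∈ U
  · have : S.set e i ⊆ U := fun x hxs => by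
      by_contra hxU
      exact hn ⟨⟨_, S.chosen_mem e he i hi, hx⟩, x, hxs, hxU⟩
    simp [hx, softMass_of_subset u (S.set_nonempty he hi) this]
  · have : ∀ x ∈ S.set e i, x ∉ U := fun x hxs hxU =>
      hn ⟨⟨x, hxs, hxU⟩, _, S.chosen_mem e he i hi, hx⟩
    simp [hx, softMass_of_disjoint u this]

lemma score_eq_sum_edgeCut : S.score U u = ∑ e ∈ edgeCut E U, S.edgeScore U u e := by
  rw [score, edgeCut, Finset.sum_filter]
  refine Finset.sum_congr rfl fun e he => ?_
  by_cases h : Crosses e U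
  · simp [h]
  · simp only [h, if_false]; exact S.edgeScore_eq_zero_of_not_crosses he h

/-- Two maximizers differ by a constant when every proper set of vertices is crossed by an
edge. -/
lemma eq_of_forall_le [Fintype V] [Nonempty V]
    (hcut : ∀ U : Finset V, U.Nonempty → Uᶜ.Nonempty → (edgeCut E U).Nonempty)
    (hu : ∀ u', S.logLik u' ≤ S.logLik u) (hv : ∀ v', S.logLik v' ≤ S.logLik v)
    (hsum : ∑ x, u x = ∑ x, v x) : v = u := by
  obtain ⟨a, -, ha⟩ := Finset.exists_max_image Finset.univ (fun x => v x - u x)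
    Finset.univ_nonempty
  -- The set where `v - u` is maximal. Finiteness leaves a positive gap to the other values, so a
  -- crossing edge makes the scores at `u` and `v` differ, although both vanish.
  set U : Finset V := {x | v a - u a ≤ v x - u x} with hU
  have hconst : ∀ x, v x - u x = v a - u a := by
    by_contra hne
    push Not at hne
    obtain ⟨y, hy⟩ := hne
    have hyU : y ∈ Uᶜ := by
      simp only [hU, Finset.mem_compl, Finset.mem_filter, Finset.mem_univ, true_and, not_le]
      exact lt_of_le_of_ne (ha y (Finset.mem_univ y)) hy
    obtain ⟨e₀, he₀⟩ := hcut U ⟨a, by simp [hU]⟩ ⟨y, hyU⟩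
    obtain ⟨b, hbU, hb⟩ := Finset.exists_max_image Uᶜ (fun x => v x - u x) ⟨y, hyU⟩
    have hlt : v b - u b < v a - u a := by
      simpa only [hU, Finset.mem_compl, Finset.mem_filter, Finset.mem_univ, true_and,
        not_le] using hbU
    have h1 : ∀ e : Finset V, ∀ x ∈ e, x ∈ U → v a - u a ≤ v x - u x := fun e x _ hx => by
      simpa only [hU, Finset.mem_filter, Finset.mem_univ, true_and] using hx
    have h2 : ∀ e : Finset V, ∀ x ∈ e, x ∉ U →
        v x - u x ≤ (v a - u a) - ((v a - u a) - (v b - u b)) := fun e x _ hx => by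
      have := hb x (by simpa using hx)
      linarith
    rw [edgeCut, Finset.mem_filter] at he₀
    have : S.score U v < S.score U u :=
      Finset.sum_lt_sum (fun e he => S.edgeScore_le_of_le he (h1 e)
        (fun x hx hxU => (h2 e x hx hxU).trans (by linarith)))
        ⟨e₀, he₀.1, S.edgeScore_lt_of_gap he₀.1 he₀.2 (h1 e₀) (h2 e₀) (by linarith)⟩
    rw [S.score_eq_zero_of_forall_le hu, S.score_eq_zero_of_forall_le hv] at this
    exact lt_irrefl _ this
  have h3 : ∑ x, (v x - u x) = 0 := by rw [Finset.sum_sub_distrib, hsum, sub_self]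
  simp only [hconst, Finset.sum_const, Finset.card_univ, nsmul_eq_mul, mul_eq_zero,
    Nat.cast_eq_zero, Fintype.card_ne_zero, false_or] at h3
  funext x
  linarith [hconst x]

lemma term_nonpos {e : Finset V} (he : e ∈ E) {i : S.κ e} (hi : i ∈ S.terms e) {b : V}
    (hb : b ∈ S.set e i) :
    v (S.chosen e i) - Real.log (∑ b ∈ S.set e i, Real.exp (v b)) ≤ v (S.chosen e i) - v b := by
  refine sub_le_sub_left ?_ _
  rw [Real.le_log_iff_exp_le (Finset.sum_pos (fun b _ => Real.exp_pos (v b))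
    (S.set_nonempty he hi))]
  exact Finset.single_le_sum (f := fun b => Real.exp (v b)) (fun _ _ => (Real.exp_pos _).le) hb

lemma term_nonpos' {e : Finset V} (he : e ∈ E) {i : S.κ e} (hi : i ∈ S.terms e) :
    v (S.chosen e i) - Real.log (∑ b ∈ S.set e i, Real.exp (v b)) ≤ 0 :=
  (S.term_nonpos he hi (S.chosen_mem e he i hi)).trans (sub_self _).le

lemma logLik_nonpos : S.logLik v ≤ 0 :=
  Finset.sum_nonpos fun _ he => Finset.sum_nonpos fun _ hi => S.term_nonpos' he hi

/-- All terms are nonpositive, so a single comparison lost by `b` bounds the whole log-likelihood.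
-/
lemma logLik_le_sub {e : Finset V} (he : e ∈ E) {i : S.κ e} (hi : i ∈ S.terms e) {b : V}
    (hb : b ∈ S.set e i) : S.logLik v ≤ v (S.chosen e i) - v b := by
  classical
  unfold logLik
  refine le_trans (?_ : _ ≤ ∑ i ∈ S.terms e, (v (S.chosen e i) -
    Real.log (∑ b ∈ S.set e i, Real.exp (v b)))) (le_trans (?_ : _ ≤ v (S.chosen e i) -
    Real.log (∑ b ∈ S.set e i, Real.exp (v b))) (S.term_nonpos he hi hb))
  · rw [← Finset.sum_erase_add _ _ he]
    exact add_le_of_nonpos_left (Finset.sum_nonpos fun e' he' =>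
      Finset.sum_nonpos fun i' hi' => S.term_nonpos' (Finset.mem_of_mem_erase he') hi')
  · rw [← Finset.sum_erase_add _ _ hi]
    exact add_le_of_nonpos_left (Finset.sum_nonpos fun i' hi' =>
      S.term_nonpos' he (Finset.mem_of_mem_erase hi'))

/-- If no proper set of vertices wins all its comparisons with its complement, then the
log-likelihood bounds the range of its argument. -/
lemma range_le_of_loses [Fintype V]
    (hlose : ∀ U : Finset V, U.Nonempty → Uᶜ.Nonempty →
      ∃ e ∈ E, ∃ i ∈ S.terms e, S.chosen e i ∉ U ∧ ∃ b ∈ S.set e i, b ∈ U) (v : V → ℝ) (a b : V) :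
    v a - v b ≤ Fintype.card V * (- S.logLik v) := by
  set l := - S.logLik v with hl
  have hl0 : 0 ≤ l := neg_nonneg.2 S.logLik_nonpos
  -- As long as a level set is proper it loses a comparison, and the winner lies at most `l` below
  -- the loser. So every lowering of the level by `l` gains a vertex.
  have hfin : ∀ s : ℕ, s < Fintype.card V →
      s + 1 ≤ (Finset.univ.filter fun x => v a - s * l ≤ v x).card := by
    intro s
    induction s with
    | zero => intro _; exact Finset.card_pos.2 ⟨a, by simp⟩
    | succ s ih =>
      intro hs
      have ih := ih (by omega)
      set U : Finset V := Finset.univ.filter fun x => v a - s * l ≤ v x with hU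
      have hne : U.Nonempty := Finset.card_pos.1 (by omega)
      have hsub : U ⊆ Finset.univ.filter fun x => v a - (s + 1 : ℕ) * l ≤ v x := by
        intro x hx
        simp only [hU, Finset.mem_filter, Finset.mem_univ, true_and] at hx ⊢
        push_cast
        linarith
      by_cases hc : Uᶜ.Nonempty
      · obtain ⟨e, he, i, hi, hcU, b, hb, hbU⟩ := hlose U hne hc
        have h1 := S.logLik_le_sub (v := v) he hi hb
        have h2 : insert (S.chosen e i) U ⊆
            Finset.univ.filter fun x => v a - (s + 1 : ℕ) * l ≤ v x := by
          refine Finset.insert_subset ?_ hsub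
          simp only [hU, Finset.mem_filter, Finset.mem_univ, true_and] at hbU ⊢
          push_cast
          linarith
        have h3 := Finset.card_le_card h2
        rw [Finset.card_insert_of_notMem hcU] at h3
        omega
      · rw [Finset.not_nonempty_iff_eq_empty, Finset.compl_eq_empty_iff] at hc
        rw [hc, Finset.univ_subset_iff] at hsub
        rw [hsub, Finset.card_univ]
        omega
  have hV : 0 < Fintype.card V := Fintype.card_pos_iff.2 ⟨a⟩
  have h := hfin (Fintype.card V - 1) (by omega)
  have huniv : (Finset.univ.filter fun x => v a - (Fintype.card V - 1 : ℕ) * l ≤ v x) =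
      Finset.univ :=
    Finset.eq_univ_of_card _ (le_antisymm (Finset.card_le_univ _) (by omega))
  have hb := Finset.mem_univ b
  rw [← huniv, Finset.mem_filter] at hb
  have hcast : ((Fintype.card V - 1 : ℕ) : ℝ) ≤ Fintype.card V := by exact_mod_cast Nat.sub_le _ _
  nlinarith [hb.2]

/-- A maximizer on the sum-zero hyperplane exists when every proper set of vertices loses some
comparison with its complement. -/
lemma exists_max_of_loses [Fintype V]
    (hlose : ∀ U : Finset V, U.Nonempty → Uᶜ.Nonempty →
      ∃ e ∈ E, ∃ i ∈ S.terms e, S.chosen e i ∉ U ∧ ∃ b ∈ S.set e i, b ∈ U) :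
    ∃ v : V → ℝ, ∑ x, v x = 0 ∧ ∀ v' : V → ℝ, ∑ x, v' x = 0 → S.logLik v' ≤ S.logLik v := by
  -- `R` bounds the range of any `v'` that does at least as well as `0`; with sum zero it also
  -- bounds the entries, so the search is confined to a compact box.
  set R : ℝ := Fintype.card V * (- S.logLik 0) with hR
  have hR0 : 0 ≤ R := mul_nonneg (Nat.cast_nonneg _) (neg_nonneg.2 S.logLik_nonpos)
  set C : Set (V → ℝ) := Set.Icc (fun _ => -R) (fun _ => R) ∩ {v | ∑ x, v x = 0} with hC
  have hCc : IsCompact C := isCompact_Icc.inter_right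
    (isClosed_eq (by fun_prop) continuous_const)
  have hcont : ContinuousOn S.logLik C := by
    refine Continuous.continuousOn ?_
    unfold logLik
    refine continuous_finsetSum _ fun e he => continuous_finsetSum _ fun i hi => ?_
    refine (continuous_apply _).sub (Continuous.log (by fun_prop) fun v => ?_)
    exact (Finset.sum_pos (fun b _ => Real.exp_pos (v b)) (S.set_nonempty he hi)).ne'
  have h0 : (0 : V → ℝ) ∈ C :=
    ⟨⟨fun _ => by simpa using hR0, fun _ => by simpa using hR0⟩, by simp⟩
  obtain ⟨v, hvC, hv⟩ := hCc.exists_isMaxOn ⟨0, h0⟩ hcont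
  refine ⟨v, hvC.2, fun v' hv' => ?_⟩
  by_cases hmem : v' ∈ C
  · exact hv hmem
  refine le_trans ?_ (hv h0)
  by_contra hlt
  push Not at hlt
  refine hmem ⟨?_, hv'⟩
  have hrange : ∀ a b, v' a - v' b ≤ R := fun a b =>
    (S.range_le_of_loses hlose v' a b).trans (by rw [hR]; gcongr)
  constructor <;> intro x
  · have h1 : ∑ y, (v' y - v' x) ≤ ∑ _y : V, R := Finset.sum_le_sum fun y _ => hrange y x
    rw [Finset.sum_sub_distrib, hv'] at h1
    simp only [Finset.sum_const, Finset.card_univ, nsmul_eq_mul, zero_sub] at h1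
    have hV : (0 : ℝ) < Fintype.card V := by exact_mod_cast Fintype.card_pos_iff.2 ⟨x⟩
    change -R ≤ v' x
    nlinarith
  · have h1 : ∑ y, (v' x - v' y) ≤ ∑ _y : V, R := Finset.sum_le_sum fun y _ => hrange x y
    rw [Finset.sum_sub_distrib, hv'] at h1
    simp only [Finset.sum_const, Finset.card_univ, nsmul_eq_mul, sub_zero] at h1
    have hV : (0 : ℝ) < Fintype.card V := by exact_mod_cast Fintype.card_pos_iff.2 ⟨x⟩
    change v' x ≤ R
    nlinarith

end ChoiceModel

/-! ### Growth of block volumes along level sets. -/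

/-- Away from the middle the growth is geometric: for small `a` the first logarithm gains at least
`log (1 + κ)`, and for `a` close to `A` the second one loses at least `κ`. The summands `1` keep the
potential finite at both ends. -/
lemma log_potential_step {A a a' κ : ℝ} (hκ : 0 ≤ κ) (hκ1 : κ ≤ 1) (ha : 0 ≤ a) (haA : a' ≤ A)
    (h : κ * (1 + min a (A - a)) ≤ a' - a) :
    κ / 2 ≤ (Real.log (1 + a') - Real.log (1 + A - a')) -
      (Real.log (1 + a) - Real.log (1 + A - a)) := by
  have haa' : a ≤ a' := by
    rcases le_total 0 (1 + min a (A - a)) with h0 | h0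
    · nlinarith [mul_nonneg hκ h0]
    · have : min a (A - a) = A - a ∨ min a (A - a) = a := by
        rcases min_choice a (A - a) with h | h <;> simp [h]
      rcases this with h1 | h1 <;> rw [h1] at h h0 <;> nlinarith
  have m1 : Real.log (1 + a) ≤ Real.log (1 + a') := Real.log_le_log (by linarith) (by linarith)
  have m2 : Real.log (1 + A - a') ≤ Real.log (1 + A - a) :=
    Real.log_le_log (by linarith) (by linarith)
  rcases min_choice a (A - a) with hm | hm <;> rw [hm] at h
  · have h1 : Real.log (1 + κ) + Real.log (1 + a) ≤ Real.log (1 + a') := by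
      rw [← Real.log_mul (by positivity) (by positivity)]
      exact Real.log_le_log (by positivity) (by nlinarith)
    have h2 := Real.one_sub_inv_le_log_of_pos (show 0 < 1 + κ by linarith)
    have h3 : κ / 2 ≤ 1 - (1 + κ)⁻¹ := by
      have : 0 < 1 + κ := by linarith
      rw [← sub_nonneg]
      have e : 1 - (1 + κ)⁻¹ - κ / 2 = κ * (1 - κ) / (2 * (1 + κ)) := by field_simp; ring
      rw [e]
      exact div_nonneg (mul_nonneg hκ (by linarith)) (by linarith)
    linarith
  · have p1 : 0 < 1 + A - a := by linarith
    have p2 : 0 < 1 + A - a' := by linarith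
    have h2 := Real.one_sub_inv_le_log_of_pos (div_pos p1 p2)
    rw [inv_div, Real.log_div p1.ne' p2.ne'] at h2
    have h3 : (1 + A - a') / (1 + A - a) ≤ 1 - κ := by
      rw [div_le_iff₀ p1]; nlinarith
    linarith

/-- Finitely many bounded monotone sequences make only logarithmically many steps if at each
step one of them grows by a fraction of its distance to the ends of its range. -/
lemma card_steps_le {P : Type*} [Fintype P] {A κ : ℝ} (hκ : 0 ≤ κ) (hκ1 : κ ≤ 1)
    (a : P → ℕ → ℝ) (tot : P → ℝ) (T : ℕ) (ha0 : ∀ p s, 0 ≤ a p s) (hatot : ∀ p s, a p s ≤ tot p)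
    (htot : ∀ p, tot p ≤ A) (hmono : ∀ p s, a p s ≤ a p (s + 1))
    (hstep : ∀ s < T, ∃ p, κ * (1 + min (a p s) (tot p - a p s)) ≤ a p (s + 1) - a p s) :
    T * (κ / 2) ≤ Fintype.card P * (2 * Real.log (1 + A)) := by
  classical
  set φ : P → ℕ → ℝ := fun p s => Real.log (1 + a p s) - Real.log (1 + tot p - a p s) with hφ
  have hφm : ∀ p s, φ p s ≤ φ p (s + 1) := by
    intro p s
    have m1 : Real.log (1 + a p s) ≤ Real.log (1 + a p (s + 1)) :=
      Real.log_le_log (by linarith [ha0 p s]) (by linarith [hmono p s])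
    have m2 : Real.log (1 + tot p - a p (s + 1)) ≤ Real.log (1 + tot p - a p s) :=
      Real.log_le_log (by linarith [hatot p (s + 1)]) (by linarith [hmono p s])
    simp only [hφ]; linarith
  have hsum : ∀ s < T, κ / 2 ≤ ∑ p, φ p (s + 1) - ∑ p, φ p s := by
    intro s hs
    obtain ⟨p, hp⟩ := hstep s hs
    rw [← Finset.sum_sub_distrib]
    refine le_trans ?_ (Finset.single_le_sum (f := fun p => φ p (s + 1) - φ p s)
      (fun q _ => sub_nonneg.2 (hφm q s)) (Finset.mem_univ p))
    exact log_potential_step hκ hκ1 (ha0 p s) (hatot p (s + 1)) hp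
  have htele : T * (κ / 2) ≤ ∑ p, φ p T - ∑ p, φ p 0 := by
    rw [← Finset.sum_range_sub (fun s => ∑ p, φ p s) T]
    calc (T : ℝ) * (κ / 2) = ∑ s ∈ Finset.range T, κ / 2 := by simp
      _ ≤ _ := Finset.sum_le_sum fun s hs => hsum s (Finset.mem_range.1 hs)
  refine htele.trans ?_
  rw [← Finset.sum_sub_distrib]
  have : ∀ p ∈ Finset.univ, φ p T - φ p 0 ≤ 2 * Real.log (1 + A) := by
    intro p _
    have h1 : Real.log (1 + a p T) ≤ Real.log (1 + A) :=
      Real.log_le_log (by linarith [ha0 p T]) (by linarith [hatot p T, htot p])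
    have h2 : 0 ≤ Real.log (1 + tot p - a p T) := Real.log_nonneg (by linarith [hatot p T])
    have h3 : 0 ≤ Real.log (1 + a p 0) := Real.log_nonneg (by linarith [ha0 p 0])
    have h4 : Real.log (1 + tot p - a p 0) ≤ Real.log (1 + A) :=
      Real.log_le_log (by linarith [hatot p 0]) (by linarith [ha0 p 0, htot p])
    simp only [hφ]; linarith
  refine (Finset.sum_le_card_nsmul _ _ _ this).trans ?_
  simp

section Chain

variable {V B : Type*} [DecidableEq V] [DecidableEq B]

/-- The number of edges that join `x` to another vertex of the block `i`. -/
def blockDeg (E : Finset (Finset V)) (c : V → B) (i : B) (x : V) : ℕ :=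
  (E.filter fun e => x ∈ e ∧ ∃ y ∈ e, y ≠ x ∧ c y = i).card

/-- The total number of edges that join the vertices of `A` in the block `j` to the
block `i`. -/
def blockVol (E : Finset (Finset V)) (c : V → B) (i j : B) (A : Finset V) : ℕ :=
  ∑ x ∈ A with c x = j, blockDeg E c i x

lemma blockVol_mono (E : Finset (Finset V)) (c : V → B) (i j : B) {A A' : Finset V}
    (h : A ⊆ A') : blockVol E c i j A ≤ blockVol E c i j A' :=
  Finset.sum_le_sum_of_subset (Finset.filter_subset_filter _ h)

lemma blockVol_union (E : Finset (Finset V)) (c : V → B) (i j : B) {A A' : Finset V}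
    (h : Disjoint A A') :
    blockVol E c i j (A ∪ A') = blockVol E c i j A + blockVol E c i j A' := by
  unfold blockVol
  rw [Finset.filter_union, Finset.sum_union (Finset.disjoint_filter_filter h)]

lemma blockVol_add_compl [Fintype V] (E : Finset (Finset V)) (c : V → B) (i j : B) (A : Finset V) :
    blockVol E c i j A + blockVol E c i j Aᶜ = blockVol E c i j Finset.univ := by
  rw [← blockVol_union _ _ _ _ disjoint_compl_right, Finset.union_compl]

lemma blockVol_le [Fintype V] (E : Finset (Finset V)) (c : V → B) (i j : B) (A : Finset V) :
    blockVol E c i j A ≤ Fintype.card V * E.card := by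
  unfold blockVol
  refine (Finset.sum_le_card_nsmul _ _ E.card fun x _ => Finset.card_filter_le _ _).trans ?_
  rw [smul_eq_mul]
  exact Nat.mul_le_mul_right _ (Finset.card_le_univ _)

/-- The edges between two disjoint sets `U` and `W` are witnessed by the volume of `W` towards
some pair of blocks. -/
lemma card_meeting_le_sum_blockVol [Fintype B] (E : Finset (Finset V)) (c : V → B) {U W : Finset V}
    (hUW : Disjoint U W) :
    (E.filter fun e => (∃ x ∈ e, x ∈ U) ∧ ∃ y ∈ e, y ∈ W).card ≤
      ∑ p : B × B, blockVol E c p.1 p.2 W := by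
  have hsub : (E.filter fun e => (∃ x ∈ e, x ∈ U) ∧ ∃ y ∈ e, y ∈ W) ⊆
      Finset.univ.biUnion fun p : B × B => (W.filter fun y => c y = p.2).biUnion fun y =>
        E.filter fun e => y ∈ e ∧ ∃ x ∈ e, x ≠ y ∧ c x = p.1 := by
    intro e he
    simp only [Finset.mem_filter] at he
    obtain ⟨heE, ⟨x, hxe, hxU⟩, y, hye, hyW⟩ := he
    simp only [Finset.mem_biUnion, Finset.mem_univ, true_and, Finset.mem_filter]
    refine ⟨(c x, c y), y, ⟨hyW, rfl⟩, heE, hye, x, hxe, ?_, rfl⟩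
    rintro rfl
    exact Finset.disjoint_left.1 hUW hxU hyW
  refine (Finset.card_le_card hsub).trans (Finset.card_biUnion_le.trans ?_)
  exact Finset.sum_le_sum fun p _ => Finset.card_biUnion_le

/-- Pigeonhole: the layer `W` is met by half of the cut edges, each counted in its volume for some
pair of blocks, so one pair receives its share of the cut. The cut is at least `1` and dominates
every smaller volume up to `C`. -/
lemma exists_blockVol_growth [Fintype V] [Fintype B] (E : Finset (Finset V)) (c : V → B) {C : ℝ} (hC : 0 ≤ C)
    {U W : Finset V} (hUW : Disjoint U W) (hcut : (edgeCut E U).Nonempty)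
    (hvol : ∀ i j, min (blockVol E c i j U : ℝ) (blockVol E c i j Uᶜ) ≤ C * (edgeCut E U).card)
    (hhalf : (edgeCut E U).card ≤
      2 * ((edgeCut E U).filter fun e => ∃ y ∈ e, y ∈ W).card) :
    ∃ p : B × B, 1 / (2 * Fintype.card (B × B) * (1 + C)) *
      (1 + min (blockVol E c p.1 p.2 U : ℝ) (blockVol E c p.1 p.2 Uᶜ)) ≤
        blockVol E c p.1 p.2 W := by
  have hN : (1 : ℝ) ≤ (edgeCut E U).card := by exact_mod_cast Finset.card_pos.2 hcut
  have h1 : ((edgeCut E U).filter fun e => ∃ y ∈ e, y ∈ W).card ≤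
      ∑ p : B × B, blockVol E c p.1 p.2 W := by
    refine le_trans (Finset.card_le_card ?_) (card_meeting_le_sum_blockVol E c hUW)
    intro e he
    simp only [edgeCut, Finset.mem_filter, Crosses] at he ⊢
    exact ⟨he.1.1, he.1.2.1, he.2⟩
  have h2 : ((edgeCut E U).card : ℝ) ≤ 2 * ∑ p : B × B, (blockVol E c p.1 p.2 W : ℝ) := by
    exact_mod_cast hhalf.trans (Nat.mul_le_mul_left 2 h1)
  by_contra! hcon
  have hne : Nonempty (B × B) := by
    by_contra hem
    rw [not_nonempty_iff] at hem
    simp only [Finset.univ_eq_empty, Finset.sum_empty, mul_zero] at h2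
    linarith
  have hq : (0 : ℝ) < Fintype.card (B × B) := by exact_mod_cast Fintype.card_pos
  have h3 : ∑ p : B × B, (blockVol E c p.1 p.2 W : ℝ) <
      ∑ _p : B × B, 1 / (2 * Fintype.card (B × B) * (1 + C)) *
        ((1 + C) * (edgeCut E U).card) := by
    refine Finset.sum_lt_sum_of_nonempty Finset.univ_nonempty fun p _ =>
      (hcon p).trans_le ?_
    gcongr
    nlinarith [hvol p.1 p.2]
  rw [Finset.sum_const, Finset.card_univ, nsmul_eq_mul] at h3
  have h4 : (Fintype.card (B × B) : ℝ) * (1 / (2 * Fintype.card (B × B) * (1 + C)) *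
      ((1 + C) * (edgeCut E U).card)) = (edgeCut E U).card / 2 := by
    have : (1 + C) ≠ 0 := by positivity
    field_simp
  linarith

/-- If half of the edges leaving any small upper level set of `δ` reach the next level set, then
logarithmically many levels contain more than half of the vertices. -/
lemma card_levelSet_gt [Fintype V] [Fintype B] (E : Finset (Finset V)) (c : V → B) {C : ℝ} (hC : 0 ≤ C)
    (hcut : ∀ U : Finset V, U.Nonempty → 2 * U.card ≤ Fintype.card V → (edgeCut E U).Nonempty)
    (hvol : ∀ U : Finset V, U.Nonempty → 2 * U.card ≤ Fintype.card V → ∀ i j,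
      min (blockVol E c i j U : ℝ) (blockVol E c i j Uᶜ) ≤ C * (edgeCut E U).card)
    (δ : V → ℝ) {D : ℝ} (hD : 0 ≤ D)
    (hstep : ∀ t, ∀ U : Finset V, U = Finset.univ.filter (fun x => t ≤ δ x) → U.Nonempty →
      2 * U.card ≤ Fintype.card V →
      (edgeCut E U).card ≤
        2 * ((edgeCut E U).filter fun e => ∃ y ∈ e, t - D ≤ δ y ∧ δ y < t).card)
    {T : ℕ} (hT : Fintype.card (B × B) *
      (2 * Real.log (1 + (Fintype.card V * E.card : ℕ))) <
        T * (1 / (2 * Fintype.card (B × B) * (1 + C)) / 2)) (a : V) :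
    Fintype.card V < 2 * (Finset.univ.filter fun x => δ a - T * D ≤ δ x).card := by
  by_contra! hsmall
  set S : ℕ → Finset V := fun s => Finset.univ.filter fun x => δ a - s * D ≤ δ x with hS
  have hSm : ∀ s, S s ⊆ S (s + 1) := by
    intro s x hx
    simp only [hS, Finset.mem_filter, Finset.mem_univ, true_and] at hx ⊢
    push_cast
    linarith
  have hSmono : Monotone S := monotone_nat_of_le_succ hSm
  have hne : ∀ s, (S s).Nonempty := fun s =>
    ⟨a, by simp only [hS, Finset.mem_filter, Finset.mem_univ, true_and]
           nlinarith [Nat.cast_nonneg (α := ℝ) s]⟩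
  have hB : 0 < Fintype.card (B × B) := by
    have : Nonempty (B × B) := ⟨(c a, c a)⟩
    exact Fintype.card_pos
  have hB1 : (1 : ℝ) ≤ Fintype.card (B × B) := by exact_mod_cast hB
  refine absurd hT (not_lt.2 (card_steps_le (κ := 1 / (2 * Fintype.card (B × B) * (1 + C)))
    (by positivity) ?_ (fun p s => (blockVol E c p.1 p.2 (S s) : ℝ))
    (fun p => (blockVol E c p.1 p.2 Finset.univ : ℝ)) T (fun p s => Nat.cast_nonneg _)
    (fun p s => ?_) (fun p => ?_) (fun p s => ?_) (fun s hs => ?_)))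
  · rw [div_le_one (by positivity)]
    nlinarith
  · exact_mod_cast blockVol_mono E c _ _ (Finset.subset_univ _)
  · exact_mod_cast blockVol_le E c _ _ _
  · exact_mod_cast blockVol_mono E c _ _ (hSm s)
  -- Under the contrary assumption the last level set is small, so all the earlier ones are small as
  -- well and each of the `T` steps produces growth.
  · have hcs : 2 * (S s).card ≤ Fintype.card V :=
      le_trans (Nat.mul_le_mul_left 2 (Finset.card_le_card (hSmono hs.le))) hsmall
    have hst := hstep (δ a - s * D) (S s) rfl (hne s) hcs
    obtain ⟨p, hp⟩ := exists_blockVol_growth E c hC (U := S s) (W := S (s + 1) \ S s)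
      Finset.disjoint_sdiff (hcut _ (hne s) hcs) (hvol _ (hne s) hcs) (by
        refine hst.trans (Nat.mul_le_mul_left 2 (Finset.card_le_card ?_))
        refine Finset.monotone_filter_right _ fun e he => ?_
        rintro ⟨y, hy, hy1, hy2⟩
        refine ⟨y, hy, ?_⟩
        simp only [hS, Finset.mem_sdiff, Finset.mem_filter, Finset.mem_univ, true_and]
        push_cast
        exact ⟨by linarith, by linarith⟩)
    refine ⟨p, ?_⟩
    have h1 := blockVol_add_compl E c p.1 p.2 (S s)
    have h2 := blockVol_union E c p.1 p.2 (Finset.disjoint_sdiff (s := S s) (t := S (s + 1)))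
    rw [Finset.union_sdiff_of_subset (hSm s)] at h2
    have h1' : (blockVol E c p.1 p.2 Finset.univ : ℝ) =
      blockVol E c p.1 p.2 (S s) + blockVol E c p.1 p.2 (S s)ᶜ := by exact_mod_cast h1.symm
    have h2' : (blockVol E c p.1 p.2 (S (s + 1)) : ℝ) = blockVol E c p.1 p.2 (S s) +
      blockVol E c p.1 p.2 (S (s + 1) \ S s) := by exact_mod_cast h2
    rw [h1', h2']
    simpa using hp

end Chain

/-! ### Deterministic consistency. -/

namespace ChoiceModel

variable {V B : Type*} [DecidableEq V] {E : Finset (Finset V)} (S : ChoiceModel E)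
  {u v : V → ℝ}

/-- Every edge across a gap of `v - u` contributes to the difference of the scores. -/
lemma score_gap {L m : ℝ} (hL : ∀ x, |u x| ≤ L) (hm : ∀ e ∈ E, (e.card : ℝ) ≤ m)
    {U : Finset V} {t D : ℝ} (hD : 0 ≤ D) (hD1 : D ≤ 1) (hU : ∀ x ∈ U, t ≤ v x - u x)
    (hU' : ∀ x, x ∉ U → v x - u x ≤ t) {F : Finset (Finset V)} (hF : F ⊆ edgeCut E U)
    (hgap : ∀ e ∈ F, ∃ t', (∀ x ∈ e, x ∈ U → t' ≤ v x - u x) ∧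
      ∀ x ∈ e, x ∉ U → v x - u x ≤ t' - D) :
    Real.exp (-4 * L) / (3 * m ^ 2) * D * F.card ≤ S.score U u - S.score U v := by
  have hFE : F ⊆ E := hF.trans (Finset.filter_subset _ _)
  rw [score, score, ← Finset.sum_sub_distrib, mul_comm, ← nsmul_eq_mul]
  refine le_trans (Finset.card_nsmul_le_sum F _ _ fun e he => ?_)
    (Finset.sum_le_sum_of_subset_of_nonneg hFE fun e he _ => sub_nonneg.2
      (S.edgeScore_le_of_le he (fun x _ hx => hU x hx) (fun x _ hx => hU' x hx)))
  obtain ⟨t', h1, h2⟩ := hgap e he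
  have hc := (Finset.mem_filter.1 (hF he)).2
  have := S.edgeScore_add_le_of_gap hL (hFE he) (hm e (hFE he)) hc h1 h2 hD hD1
  linarith

/-- Constants do not change the log-likelihood, so the constraint costs nothing and the score of
every set vanishes at a constrained maximizer. -/
lemma forall_le_of_constrained [Fintype V] [Nonempty V]
    (hv : ∀ v' : V → ℝ, ∑ x, v' x = 0 → S.logLik v' ≤ S.logLik v) (v' : V → ℝ) :
    S.logLik v' ≤ S.logLik v := by
  rw [← S.logLik_add_const v' (-((∑ x, v' x) / Fintype.card V))]
  refine hv _ ?_
  have : (Fintype.card V : ℝ) ≠ 0 := by exact_mod_cast Fintype.card_ne_zero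
  rw [Finset.sum_add_distrib, Finset.sum_const, Finset.card_univ, nsmul_eq_mul]
  field_simp
  ring

section Consistency

variable {L m b ℓ z : ℝ}

/-- The edge expansion `z * q ≤ N` turns the fluctuation of a score into a small multiple of the cut
itself. -/
lemma sqrt_cut_le (hz : 0 < z) (hℓ : 0 ≤ ℓ) {N q : ℝ} (hN : 0 ≤ N) (hzN : z * q ≤ N) :
    Real.sqrt (N * q * ℓ) ≤ N * Real.sqrt (ℓ / z) := by
  rw [show N * Real.sqrt (ℓ / z) = Real.sqrt (N ^ 2 * (ℓ / z)) by
    rw [Real.sqrt_mul (sq_nonneg N), Real.sqrt_sq hN]]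
  refine Real.sqrt_le_sqrt ?_
  have : q ≤ N / z := by rw [le_div_iff₀ hz]; linarith
  calc N * q * ℓ ≤ N * (N / z) * ℓ := by gcongr
    _ = N ^ 2 * (ℓ / z) := by field_simp

/-- Half of the edges that leave a small set across which `v - u` has a gap must end in the
gap. -/
lemma cut_le_of_score (hL : ∀ x, |u x| ≤ L) (hm : ∀ e ∈ E, (e.card : ℝ) ≤ m) (hb : 0 < b)
    (hm1 : 1 ≤ m) (hz : 0 < z) (hℓ : 0 < ℓ) {D : ℝ}
    (hDdef : D = 2 * b / (Real.exp (-4 * L) / (3 * m ^ 2)) * Real.sqrt (ℓ / z)) (hD1 : D ≤ 1)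
    {U₀ U : Finset V} (hUU : edgeCut E U = edgeCut E U₀)
    (hscore : |S.score U u| = |S.score U₀ u|) (hcut : z * U₀.card ≤ (edgeCut E U₀).card)
    (hG : |S.score U₀ u| ≤ b * Real.sqrt ((edgeCut E U₀).card * U₀.card * ℓ))
    (hv : S.score U v = 0) {t : ℝ} (hU : ∀ x ∈ U, t ≤ v x - u x)
    (hU' : ∀ x, x ∉ U → v x - u x ≤ t) {p : Finset V → Prop} [DecidablePred p]
    (hgap : ∀ e ∈ edgeCut E U, ¬ p e → ∃ t', (∀ x ∈ e, x ∈ U → t' ≤ v x - u x) ∧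
      ∀ x ∈ e, x ∉ U → v x - u x ≤ t' - D) :
    (edgeCut E U₀).card ≤ 2 * ((edgeCut E U₀).filter p).card := by
  by_contra! hlt
  have hκ : 0 < Real.exp (-4 * L) / (3 * m ^ 2) := by positivity
  have hsq : 0 < Real.sqrt (ℓ / z) := Real.sqrt_pos.2 (by positivity)
  have hD : 0 < D := by rw [hDdef]; positivity
  set κ := Real.exp (-4 * L) / (3 * m ^ 2) with hκdef
  have h1 := S.score_gap hL hm hD.le hD1 hU hU' (F := (edgeCut E U).filter fun e => ¬ p e)
    (Finset.filter_subset _ _) (fun e he => hgap e (Finset.mem_filter.1 he).1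
      (Finset.mem_filter.1 he).2)
  rw [hv, sub_zero, hUU] at h1
  have h2 : (edgeCut E U₀).card < 2 * ((edgeCut E U₀).filter fun e => ¬ p e).card := by
    have := Finset.card_filter_add_card_filter_not (s := edgeCut E U₀) p
    omega
  have h2' : ((edgeCut E U₀).card : ℝ) <
    2 * ((edgeCut E U₀).filter fun e => ¬ p e).card := by exact_mod_cast h2
  have h3 : S.score U u ≤ b * ((edgeCut E U₀).card * Real.sqrt (ℓ / z)) :=
    (le_abs_self _).trans (hscore.le.trans (hG.trans
      (mul_le_mul_of_nonneg_left (sqrt_cut_le hz hℓ.le (Nat.cast_nonneg _) hcut) hb.le)))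
  have h4 : κ * D = 2 * b * Real.sqrt (ℓ / z) := by rw [hDdef]; field_simp
  rw [h4] at h1
  have h5 : 0 < b * Real.sqrt (ℓ / z) := by positivity
  nlinarith

/-- Deterministic consistency: if small sets of vertices have large edge boundaries that control
their volumes, and if the scores of small sets at `u` are small, then the maximizer of the
log-likelihood exists, is unique, and is close to `u`. -/
theorem exists_unique_and_close [Fintype V] [Nonempty V] [Fintype B] [DecidableEq B] (c : V → B)
    (hu : ∑ x, u x = 0)
    (hL : ∀ x, |u x| ≤ L) (hm : ∀ e ∈ E, (e.card : ℝ) ≤ m) (hb : 0 < b)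
    (hm1 : 1 ≤ m) (hz : 0 < z) (hℓ : 0 < ℓ) {D : ℝ}
    (hDdef : D = 2 * b / (Real.exp (-4 * L) / (3 * m ^ 2)) * Real.sqrt (ℓ / z)) (hD1 : D ≤ 1)
    {C : ℝ} (hC : 0 ≤ C)
    (hcut : ∀ U : Finset V, U.Nonempty → 2 * U.card ≤ Fintype.card V →
      z * U.card ≤ (edgeCut E U).card)
    (hvol : ∀ U : Finset V, U.Nonempty → 2 * U.card ≤ Fintype.card V → ∀ i j,
      min (blockVol E c i j U : ℝ) (blockVol E c i j Uᶜ) ≤ C * (edgeCut E U).card)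
    (hG : ∀ U : Finset V, U.Nonempty → 2 * U.card ≤ Fintype.card V →
      |S.score U u| ≤ b * Real.sqrt ((edgeCut E U).card * U.card * ℓ))
    {T : ℕ} (hT : Fintype.card (B × B) *
      (2 * Real.log (1 + (Fintype.card V * E.card : ℕ))) <
        T * (1 / (2 * Fintype.card (B × B) * (1 + C)) / 2)) :
    (∃! v : V → ℝ, ∑ x, v x = 0 ∧ ∀ v' : V → ℝ, ∑ x, v' x = 0 → S.logLik v' ≤ S.logLik v) ∧
    ∀ v : V → ℝ, (∑ x, v x = 0 ∧ ∀ v' : V → ℝ, ∑ x, v' x = 0 → S.logLik v' ≤ S.logLik v) →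
      ∀ x, |v x - u x| ≤ 2 * T * D := by
  have hL0 : 0 ≤ L := (abs_nonneg _).trans (hL (Classical.arbitrary V))
  have hκ : 0 < Real.exp (-4 * L) / (3 * m ^ 2) := by positivity
  have hsq : 0 < Real.sqrt (ℓ / z) := Real.sqrt_pos.2 (by positivity)
  have hD : 0 < D := by rw [hDdef]; positivity
  have hcutne : ∀ U : Finset V, U.Nonempty → 2 * U.card ≤ Fintype.card V →
      (edgeCut E U).Nonempty := by
    intro U hU h
    have h1 := hcut U hU h
    have h2 : (0 : ℝ) < U.card := by exact_mod_cast Finset.card_pos.2 hU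
    rw [← Finset.card_pos]
    have : (0 : ℝ) < (edgeCut E U).card := (mul_pos hz h2).trans_le h1
    exact_mod_cast this
  have hsmall : ∀ U : Finset V, 2 * U.card ≤ Fintype.card V ∨
      2 * Uᶜ.card ≤ Fintype.card V := by
    intro U
    have := Finset.card_add_card_compl U
    omega
  have hcutne' : ∀ U : Finset V, U.Nonempty → Uᶜ.Nonempty → (edgeCut E U).Nonempty := by
    intro U hU hUc
    rcases hsmall U with h | h
    · exact hcutne U hU h
    · rw [← edgeCut_compl]; exact hcutne _ hUc h
  -- If `U` won everything, its score at `u` would be at least `exp (-2 * L) / m` per cut edge. The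
  -- noise is at most half of `exp (-4 * L) / (3 * m ^ 2)` per cut edge, because `D ≤ 1`.
  have hlose : ∀ U : Finset V, U.Nonempty → Uᶜ.Nonempty →
      ∃ e ∈ E, ∃ i ∈ S.terms e, S.chosen e i ∉ U ∧ ∃ b ∈ S.set e i, b ∈ U := by
    intro U hU hUc
    by_contra! hwin
    have hw : Real.exp (-2 * L) / m * (edgeCut E U).card ≤ S.score U u := by
      rw [score_eq_sum_edgeCut, mul_comm, ← nsmul_eq_mul]
      refine Finset.card_nsmul_le_sum _ _ _ fun e he => ?_
      obtain ⟨heE, hec⟩ := Finset.mem_filter.1 he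
      refine S.edgeScore_ge_of_wins hL heE (hm e heE) hec fun i hi hcr => ?_
      by_contra hch
      obtain ⟨x, hx, hxU⟩ := hcr.1
      exact hwin e heE i hi hch x hx hxU
    have hN : (0 : ℝ) < (edgeCut E U).card := by
      exact_mod_cast Finset.card_pos.2 (hcutne' U hU hUc)
    have hs : |S.score U u| ≤ b * ((edgeCut E U).card * Real.sqrt (ℓ / z)) := by
      rcases hsmall U with h | h
      · exact (hG U hU h).trans (mul_le_mul_of_nonneg_left
          (sqrt_cut_le hz hℓ.le (Nat.cast_nonneg _) (hcut U hU h)) hb.le)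
      · have h1 := (hG Uᶜ hUc h).trans (mul_le_mul_of_nonneg_left
          (sqrt_cut_le hz hℓ.le (Nat.cast_nonneg _) (hcut Uᶜ hUc h)) hb.le)
        rwa [score_compl, abs_neg, edgeCut_compl] at h1
    have h1 : Real.exp (-2 * L) / m ≤ b * Real.sqrt (ℓ / z) := by
      have := hw.trans ((le_abs_self _).trans hs)
      rw [show b * ((edgeCut E U).card * Real.sqrt (ℓ / z)) =
        b * Real.sqrt (ℓ / z) * (edgeCut E U).card by ring] at this
      exact le_of_mul_le_mul_right this hN
    have h2 : 2 * (b * Real.sqrt (ℓ / z)) ≤ Real.exp (-4 * L) / (3 * m ^ 2) := by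
      have e1 : D * (Real.exp (-4 * L) / (3 * m ^ 2)) = 2 * (b * Real.sqrt (ℓ / z)) := by
        rw [hDdef]; field_simp
      rw [← e1]
      exact mul_le_of_le_one_left hκ.le hD1
    have h3 : Real.exp (-4 * L) / (3 * m ^ 2) ≤ Real.exp (-2 * L) / m := by
      have : Real.exp (-4 * L) ≤ Real.exp (-2 * L) := Real.exp_le_exp.2 (by linarith)
      gcongr
      nlinarith
    have h4 : 0 < Real.exp (-2 * L) / m := by positivity
    linarith
  have hclose : ∀ v : V → ℝ, (∑ x, v x = 0 ∧
      ∀ v' : V → ℝ, ∑ x, v' x = 0 → S.logLik v' ≤ S.logLik v) →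
      ∀ x, |v x - u x| ≤ 2 * T * D := by
    intro v hv
    have hs0 := S.score_eq_zero_of_forall_le (S.forall_le_of_constrained hv.2)
    obtain ⟨a, -, ha⟩ := Finset.exists_max_image Finset.univ (fun x => v x - u x)
      Finset.univ_nonempty
    obtain ⟨d, -, hd⟩ := Finset.exists_min_image Finset.univ (fun x => v x - u x)
      Finset.univ_nonempty
    have htop := card_levelSet_gt E c hC hcutne hvol (fun x => v x - u x) hD.le (by
      rintro t U rfl hU hUs
      refine S.cut_le_of_score hL hm hb hm1 hz hℓ hDdef hD1 rfl rfl (hcut _ hU hUs)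
        (hG _ hU hUs) (hs0 _) (t := t) (fun x hx => (Finset.mem_filter.1 hx).2)
        (fun x hx => ?_) (fun e _ hp => ⟨t, fun x _ hx => (Finset.mem_filter.1 hx).2,
          fun x hxe hx => ?_⟩)
      · simp only [Finset.mem_filter, Finset.mem_univ, true_and, not_le] at hx
        exact hx.le
      · simp only [Finset.mem_filter, Finset.mem_univ, true_and, not_le] at hx
        by_contra! hcon
        exact hp ⟨x, hxe, hcon.le, hx⟩) hT a
    -- Apply the estimate to the complement of a lower level set, which has the same cut and the
    -- opposite score. Here the layer lies above the threshold `-t`, so edges avoiding it are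
    -- separated at `D - t`.
    have hbot := card_levelSet_gt E c hC hcutne hvol (fun x => -(v x - u x)) hD.le (by
      rintro t U rfl hU hUs
      refine S.cut_le_of_score hL hm hb hm1 hz hℓ hDdef hD1
        (U := (Finset.univ.filter fun x => t ≤ -(v x - u x))ᶜ) (edgeCut_compl _ _)
        (by rw [score_compl, abs_neg]) (hcut _ hU hUs)
        (hG _ hU hUs) (hs0 _) (t := -t) (fun x hx => ?_)
        (fun x hx => ?_) (fun e _ hp => ⟨D - t, fun x hxe hx => ?_, fun x _ hx => ?_⟩)
      · simp only [Finset.mem_compl, Finset.mem_filter, Finset.mem_univ, true_and, not_le] at hx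
        linarith
      · simp only [Finset.mem_compl, Finset.mem_filter, Finset.mem_univ, true_and, not_not] at hx
        linarith
      · simp only [Finset.mem_compl, Finset.mem_filter, Finset.mem_univ, true_and, not_le] at hx
        by_contra! hcon
        exact hp ⟨x, hxe, by linarith, hx⟩
      · simp only [Finset.mem_compl, Finset.mem_filter, Finset.mem_univ, true_and, not_not] at hx
        linarith) hT d
    -- Two sets that each hold more than half of the vertices share one, which bounds the range of
    -- `v - u` by `2 * T * D`.
    have hinter : (Finset.univ.filter (fun x => v a - u a - T * D ≤ v x - u x) ∩
        Finset.univ.filter (fun x => -(v d - u d) - T * D ≤ -(v x - u x))).Nonempty := by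
      rw [← Finset.card_pos]
      have h1 := Finset.card_union_add_card_inter
        (Finset.univ.filter (fun x => v a - u a - T * D ≤ v x - u x))
        (Finset.univ.filter (fun x => -(v d - u d) - T * D ≤ -(v x - u x)))
      have h2 := Finset.card_le_univ (Finset.univ.filter
        (fun x => v a - u a - T * D ≤ v x - u x) ∪
        Finset.univ.filter (fun x => -(v d - u d) - T * D ≤ -(v x - u x)))
      omega
    obtain ⟨y, hy⟩ := hinter
    simp only [Finset.mem_inter, Finset.mem_filter, Finset.mem_univ, true_and] at hy
    have hδ : ∑ x, (v x - u x) = 0 := by rw [Finset.sum_sub_distrib, hu, hv.1, sub_zero]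
    have ha0 : 0 ≤ v a - u a := by
      by_contra! h
      have := Finset.sum_neg (s := Finset.univ) (f := fun x => v x - u x)
        (fun x hx => (ha x hx).trans_lt h) Finset.univ_nonempty
      exact this.ne hδ
    have hd0 : v d - u d ≤ 0 := by
      by_contra! h
      have := Finset.sum_pos (s := Finset.univ) (f := fun x => v x - u x)
        (fun x hx => h.trans_le (hd x hx)) Finset.univ_nonempty
      exact this.ne' hδ
    intro x
    have h1 := ha x (Finset.mem_univ x)
    have h2 := hd x (Finset.mem_univ x)
    rw [abs_le]
    constructor <;> linarith [hy.1, hy.2]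
  refine ⟨?_, hclose⟩
  obtain ⟨v, hv⟩ := S.exists_max_of_loses hlose
  refine ⟨v, hv, fun w hw => ?_⟩
  exact S.eq_of_forall_le hcutne' (S.forall_le_of_constrained hv.2)
    (S.forall_le_of_constrained hw.2) (hv.1.trans hw.1.symm)

end Consistency

end ChoiceModel

/-! ### Expected cuts and expected block volumes. -/

section ExpectedCounts

variable {V B : Type*} [DecidableEq V]

/-- Two label-preserving swaps suffice: one takes `x` to `x'`, the next corrects the image of `y`
and leaves `x'` fixed. -/
lemma exists_perm_of_labels {c : V → B} {x y x' y' : V} (hxy : x ≠ y) (hxy' : x' ≠ y') (hx : c x = c x')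
    (hy : c y = c y') : ∃ σ : Equiv.Perm V, (∀ z, c (σ z) = c z) ∧ σ x = x' ∧ σ y = y' := by
  have hswap : ∀ {a b : V}, c a = c b → ∀ z, c (Equiv.swap a b z) = c z := by
    intro a b hab z
    by_cases hza : z = a
    · subst hza; rw [Equiv.swap_apply_left, hab]
    · by_cases hzb : z = b
      · subst hzb; rw [Equiv.swap_apply_right, hab]
      · rw [Equiv.swap_apply_of_ne_of_ne hza hzb]
  have h1 : c (Equiv.swap x x' y) = c y' := by rw [hswap hx, hy]
  refine ⟨(Equiv.swap x x').trans (Equiv.swap (Equiv.swap x x' y) y'), fun z => ?_, ?_, ?_⟩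
  · rw [Equiv.trans_apply, hswap h1, hswap hx]
  · rw [Equiv.trans_apply, Equiv.swap_apply_left, Equiv.swap_apply_of_ne_of_ne _ hxy']
    intro h
    exact hxy ((Equiv.swap x x').injective (by rw [← h, Equiv.swap_apply_left]))
  · rw [Equiv.trans_apply, Equiv.swap_apply_left]

variable [Fintype V]

/-- The expected number of edges that contain both `x` and `y`, when the `M`-subset `e` is an
edge with probability `p e`. -/
noncomputable def pairWeight (M : ℕ) (p : Finset V → ℝ) (x y : V) : ℝ :=
  ∑ e ∈ Finset.powersetCard M Finset.univ with x ∈ e ∧ y ∈ e, p e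

/-- The expected number of edges, counted with the pairs of vertices that they connect, between
`U` and its complement. -/
noncomputable def cutWeight (M : ℕ) (p : Finset V → ℝ) (U : Finset V) : ℝ :=
  ∑ x ∈ U, ∑ y ∈ Uᶜ, pairWeight M p x y

/-- The expectation of `blockDeg`. -/
noncomputable def meanBlockDeg [DecidableEq B] (M : ℕ) (p : Finset V → ℝ) (c : V → B) (i : B) (x : V) : ℝ :=
  ∑ e ∈ Finset.powersetCard M Finset.univ with x ∈ e ∧ ∃ y ∈ e, y ≠ x ∧ c y = i, p e

/-- The expected number of edges that cross `U`. -/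
noncomputable def meanCut (M : ℕ) (p : Finset V → ℝ) (U : Finset V) : ℝ :=
  ∑ e ∈ edgeCut (Finset.powersetCard M Finset.univ) U, p e

variable {M : ℕ} {p : Finset V → ℝ} {c : V → B}

lemma pairWeight_eq_sum_ite (x y : V) : pairWeight M p x y =
    ∑ e ∈ Finset.powersetCard M Finset.univ, if x ∈ e ∧ y ∈ e then p e else 0 :=
  Finset.sum_filter _ _

lemma pairWeight_comm (x y : V) : pairWeight M p x y = pairWeight M p y x := by
  unfold pairWeight
  simp only [and_comm]

lemma pairWeight_nonneg (hp : ∀ e, e.card = M → 0 ≤ p e) (x y : V) : 0 ≤ pairWeight M p x y :=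
  Finset.sum_nonneg fun e he => hp e
    (Finset.mem_powersetCard.1 (Finset.mem_filter.1 he).1).2

lemma pairWeight_perm (σ : Equiv.Perm V)
    (hp : ∀ e, e.card = M → p (e.map σ.toEmbedding) = p e) (x y : V) :
    pairWeight M p (σ x) (σ y) = pairWeight M p x y := by
  unfold pairWeight
  symm
  refine Finset.sum_equiv σ.finsetCongr (fun e => ?_) (fun e he => ?_)
  · simp
  · exact (hp e (Finset.mem_powersetCard.1 (Finset.mem_filter.1 he).1).2).symm

/-- When the edge probabilities depend on the labels of the vertices only, so do the pair
weights. -/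
lemma exists_pairWeight_eq (hp0 : ∀ e, e.card = M → 0 ≤ p e)
    (hp : ∀ (σ : Equiv.Perm V), (∀ z, c (σ z) = c z) →
      ∀ e, e.card = M → p (e.map σ.toEmbedding) = p e) :
    ∃ W : B → B → ℝ, (∀ i j, 0 ≤ W i j) ∧
      ∀ x y, x ≠ y → pairWeight M p x y = W (c x) (c y) := by
  classical
  -- Any representative pair serves, by symmetry. The default `0` concerns labels carried by no pair
  -- of distinct vertices and only has to be nonnegative.
  refine ⟨fun i j => if h : ∃ q : V × V, q.1 ≠ q.2 ∧ c q.1 = i ∧ c q.2 = j then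
    pairWeight M p h.choose.1 h.choose.2 else 0, fun i j => ?_, fun x y hxy => ?_⟩
  · dsimp only
    split_ifs with h
    · exact pairWeight_nonneg hp0 _ _
    · exact le_rfl
  · have h : ∃ q : V × V, q.1 ≠ q.2 ∧ c q.1 = c x ∧ c q.2 = c y := ⟨(x, y), hxy, rfl, rfl⟩
    dsimp only
    rw [dif_pos h]
    obtain ⟨h1, h2, h3⟩ := h.choose_spec
    obtain ⟨σ, hσ, hx, hy⟩ := exists_perm_of_labels h1 hxy h2 h3
    have := pairWeight_perm σ (hp σ hσ) h.choose.1 h.choose.2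
    rwa [hx, hy] at this

lemma meanBlockDeg_le [DecidableEq B] {W : B → B → ℝ} (hp0 : ∀ e, e.card = M → 0 ≤ p e)
    (hW0 : ∀ i j, 0 ≤ W i j)
    (hW : ∀ x y, x ≠ y → pairWeight M p x y = W (c x) (c y)) (i : B) (x : V) :
    meanBlockDeg M p c i x ≤ (Finset.univ.filter fun y => c y = i).card * W (c x) i := by
  have h1 : meanBlockDeg M p c i x ≤
      ∑ y ∈ Finset.univ.filter fun y => y ≠ x ∧ c y = i, pairWeight M p x y := by
    simp only [pairWeight_eq_sum_ite]
    rw [Finset.sum_comm, meanBlockDeg, Finset.sum_filter]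
    refine Finset.sum_le_sum fun e he => ?_
    have hpe := hp0 e (Finset.mem_powersetCard.1 he).2
    have hnn : ∀ y, 0 ≤ if x ∈ e ∧ y ∈ e then p e else 0 := fun y => by split_ifs <;> simp [hpe]
    split_ifs with h
    · obtain ⟨hx, y, hy, hyx, hyi⟩ := h
      refine le_trans ?_ (Finset.single_le_sum (f := fun y => if x ∈ e ∧ y ∈ e then p e else 0)
        (fun y _ => hnn y) (show y ∈ _ by simp [hyx, hyi]))
      simp [hx, hy]
    · exact Finset.sum_nonneg fun y _ => hnn y
  have h2 : ∀ y ∈ Finset.univ.filter fun y => y ≠ x ∧ c y = i,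
      pairWeight M p x y ≤ W (c x) i := by
    intro y hy
    simp only [Finset.mem_filter, Finset.mem_univ, true_and] at hy
    rw [hW x y hy.1.symm, hy.2]
  refine h1.trans ((Finset.sum_le_card_nsmul _ _ _ h2).trans ?_)
  rw [nsmul_eq_mul]
  refine mul_le_mul_of_nonneg_right ?_ (hW0 _ _)
  exact_mod_cast Finset.card_le_card (Finset.monotone_filter_right _ fun y _ (hy : y ≠ x ∧ c y = i) => hy.2)

/-- An edge contains only `M ^ 2` ordered pairs of vertices, and only a crossing edge contains a
pair separated by `U`. -/
lemma cutWeight_le (hp0 : ∀ e, e.card = M → 0 ≤ p e) (U : Finset V) :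
    cutWeight M p U ≤ (M : ℝ) ^ 2 * meanCut M p U := by
  simp only [cutWeight, pairWeight_eq_sum_ite]
  rw [meanCut, edgeCut, Finset.sum_filter, Finset.mul_sum]
  simp_rw [Finset.sum_comm (s := Uᶜ)]
  rw [Finset.sum_comm]
  refine Finset.sum_le_sum fun e he => ?_
  obtain ⟨-, hcard⟩ := Finset.mem_powersetCard.1 he
  have hpe := hp0 e hcard
  have hnn : ∀ x y, 0 ≤ if x ∈ e ∧ y ∈ e then p e else 0 := fun x y => by
    split_ifs <;> simp [hpe]
  split_ifs with h
  · calc ∑ x ∈ U, ∑ y ∈ Uᶜ, (if x ∈ e ∧ y ∈ e then p e else 0)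
        ≤ ∑ x, ∑ y, (if x ∈ e ∧ y ∈ e then p e else 0) :=
          le_trans (Finset.sum_le_sum fun x _ => Finset.sum_le_sum_of_subset_of_nonneg
            (Finset.subset_univ _) fun y _ _ => hnn x y)
            (Finset.sum_le_sum_of_subset_of_nonneg (Finset.subset_univ _) fun x _ _ =>
              Finset.sum_nonneg fun y _ => hnn x y)
      _ = (M : ℝ) ^ 2 * p e := by
          simp [ite_and, hcard, Finset.sum_ite_irrel]
          ring
  · rw [mul_zero]
    refine (Finset.sum_eq_zero fun x hx => Finset.sum_eq_zero fun y hy => if_neg ?_).le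
    exact fun hxy => h ⟨⟨x, hxy.1, hx⟩, y, hxy.2, Finset.mem_compl.1 hy⟩

lemma card_edges_through {M : ℕ} (hM : 2 ≤ M) {x y : V} (hxy : x ≠ y) :
    (Fintype.card V - 2).choose (M - 2) ≤
      ((Finset.powersetCard M (Finset.univ : Finset V)).filter fun e => x ∈ e ∧ y ∈ e).card := by
  have hc : ((Finset.univ.erase x).erase y : Finset V).card = Fintype.card V - 2 := by
    rw [Finset.card_erase_of_mem (by simp [hxy.symm]), Finset.card_erase_of_mem (by simp),
      Finset.card_univ]; omega
  rw [← hc, ← Finset.card_powersetCard]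
  have hx : ∀ s ∈ Finset.powersetCard (M - 2) ((Finset.univ.erase x).erase y : Finset V),
      x ∉ s ∧ y ∉ s := fun s hs =>
    ⟨fun h => by simpa using (Finset.mem_powersetCard.1 hs).1 h,
     fun h => by simpa using (Finset.mem_powersetCard.1 hs).1 h⟩
  refine Finset.card_le_card_of_injOn (fun s => insert x (insert y s)) (fun s hs => ?_) ?_
  · have := hx s hs
    simp only [Finset.coe_filter, Set.mem_ofPred_eq, Finset.mem_powersetCard]
    refine ⟨⟨Finset.subset_univ _, ?_⟩, by simp, by simp⟩
    rw [Finset.card_insert_of_notMem (by simp [hxy, this.1]),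
      Finset.card_insert_of_notMem this.2, (Finset.mem_powersetCard.1 hs).2]
    omega
  · intro s hs s' hs' h
    have h1 := hx s hs
    have h2 := hx s' hs'
    have e1 : ∀ s : Finset V, x ∉ s ∧ y ∉ s →
        ((insert x (insert y s)).erase x).erase y = s := by
      intro s hs
      rw [Finset.erase_insert (by simp [hxy, hs.1]), Finset.erase_insert hs.2]
    rw [← e1 s h1, ← e1 s' h2]
    exact congrArg (fun r => (r.erase x).erase y) h

lemma pow_le_card_edges_through {M : ℕ} (hM : 2 ≤ M) (hV : 2 * M ≤ Fintype.card V) {x y : V}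
    (hxy : x ≠ y) :
    (Fintype.card V : ℝ) ^ (M - 2) / (2 ^ (M - 2) * (M - 2).factorial) ≤
      ((Finset.powersetCard M (Finset.univ : Finset V)).filter fun e => x ∈ e ∧ y ∈ e).card := by
  refine le_trans ?_ (Nat.cast_le.2 (card_edges_through hM hxy))
  refine le_trans ?_ (Nat.pow_le_choose (α := ℝ) (M - 2) (Fintype.card V - 2))
  rw [← div_div, ← div_pow]
  gcongr
  rw [div_le_iff₀ two_pos]
  -- With `2 * M` at most the number of vertices, every factor of the falling product is at least
  -- half of that number.
  exact_mod_cast (by omega : Fintype.card V ≤ (Fintype.card V - 2 + 1 - (M - 2)) * 2)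

lemma cutWeight_ge {M : ℕ} (hM : 2 ≤ M) (hV : 2 * M ≤ Fintype.card V) {q : ℝ} (hq : 0 ≤ q)
    (hp : ∀ e, e.card = M → q ≤ p e) {U : Finset V} (hU : 2 * U.card ≤ Fintype.card V) :
    1 / (2 ^ (M - 1) * (M - 2).factorial) * ((Fintype.card V : ℝ) ^ (M - 1) * q) * U.card ≤
      cutWeight M p U := by
  set n := Fintype.card V with hn
  have h1 : ∀ x ∈ U, ∀ y ∈ Uᶜ,
      (n : ℝ) ^ (M - 2) / (2 ^ (M - 2) * (M - 2).factorial) * q ≤ pairWeight M p x y := by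
    intro x hx y hy
    have hxy : x ≠ y := by
      rintro rfl; exact (Finset.mem_compl.1 hy) hx
    unfold pairWeight
    refine le_trans (mul_le_mul_of_nonneg_right (pow_le_card_edges_through hM hV hxy) hq) ?_
    rw [← nsmul_eq_mul]
    exact Finset.card_nsmul_le_sum _ _ _ fun e he =>
      hp e (Finset.mem_powersetCard.1 (Finset.mem_filter.1 he).1).2
  have h2 : U.card • (Uᶜ.card • ((n : ℝ) ^ (M - 2) / (2 ^ (M - 2) * (M - 2).factorial) * q)) ≤
      cutWeight M p U :=
    Finset.card_nsmul_le_sum _ _ _ fun x hx => Finset.card_nsmul_le_sum _ _ _ (h1 x hx)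
  refine le_trans ?_ h2
  rw [nsmul_eq_mul, nsmul_eq_mul]
  have h3 : (n : ℝ) / 2 ≤ Uᶜ.card := by
    have := Finset.card_add_card_compl U
    rw [div_le_iff₀ two_pos]
    exact_mod_cast (by omega : n ≤ Uᶜ.card * 2)
  obtain ⟨k, rfl⟩ : ∃ k, M = k + 2 := ⟨M - 2, by omega⟩
  simp only [Nat.add_sub_cancel, show k + 2 - 1 = k + 1 by omega] at *
  calc 1 / (2 ^ (k + 1) * (k.factorial : ℝ)) * ((n : ℝ) ^ (k + 1) * q) * U.card
      = U.card * ((n : ℝ) / 2 * ((n : ℝ) ^ k / (2 ^ k * k.factorial) * q)) := by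
        field_simp
        ring
    _ ≤ _ := by gcongr

/-- The expected volume of the smaller side of a block is controlled by the cut weight. -/
lemma min_card_mul_le_cutWeight [DecidableEq B] {W : B → B → ℝ}
    (hp0 : ∀ e, e.card = M → 0 ≤ p e) (hW0 : ∀ i j, 0 ≤ W i j)
    (hW : ∀ x y, x ≠ y → pairWeight M p x y = W (c x) (c y)) (U : Finset V) (i j : B) :
    min ((U.filter fun x => c x = j).card : ℝ) (Uᶜ.filter fun x => c x = j).card *
      ((Finset.univ.filter fun y => c y = i).card * W j i) ≤ 2 * cutWeight M p U := by
  have hne : ∀ x ∈ U, ∀ y ∈ Uᶜ, x ≠ y := by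
    rintro x hx y hy rfl; exact (Finset.mem_compl.1 hy) hx
  have hsub : ∀ a b : B, ∑ x ∈ U.filter fun x => c x = a, ∑ y ∈ Uᶜ.filter fun y => c y = b,
      pairWeight M p x y ≤ cutWeight M p U := by
    intro a b
    unfold cutWeight
    refine le_trans (Finset.sum_le_sum fun x _ => Finset.sum_le_sum_of_subset_of_nonneg
      (Finset.filter_subset _ _) fun y _ _ => pairWeight_nonneg hp0 x y)
      (Finset.sum_le_sum_of_subset_of_nonneg (Finset.filter_subset _ _) fun x _ _ =>
        Finset.sum_nonneg fun y _ => pairWeight_nonneg hp0 x y)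
  have h1 : ((U.filter fun x => c x = i).card : ℝ) * ((Uᶜ.filter fun x => c x = j).card * W j i) ≤
      cutWeight M p U := by
    refine le_trans (le_of_eq ?_) (hsub i j)
    rw [← nsmul_eq_mul, ← nsmul_eq_mul, ← Finset.sum_const, ← Finset.sum_const]
    refine Finset.sum_congr rfl fun x hx => Finset.sum_congr rfl fun y hy => ?_
    rw [Finset.mem_filter] at hx hy
    rw [pairWeight_comm, hW y x (hne x hx.1 y hy.1).symm, hx.2, hy.2]
  have h2 : ((U.filter fun x => c x = j).card : ℝ) * ((Uᶜ.filter fun x => c x = i).card * W j i) ≤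
      cutWeight M p U := by
    refine le_trans (le_of_eq ?_) (hsub j i)
    rw [← nsmul_eq_mul, ← nsmul_eq_mul, ← Finset.sum_const, ← Finset.sum_const]
    refine Finset.sum_congr rfl fun x hx => Finset.sum_congr rfl fun y hy => ?_
    rw [Finset.mem_filter] at hx hy
    rw [hW x y (hne x hx.1 y hy.1), hx.2, hy.2]
  -- Split block `i` along `U`: its part inside `U` is paired with block `j` outside, and its part
  -- outside with block `j` inside. Both products are sums over separated pairs.
  have h3 : ((Finset.univ.filter fun y => c y = i).card : ℝ) =
      (U.filter fun x => c x = i).card + (Uᶜ.filter fun x => c x = i).card := by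
    rw [← Finset.union_compl U, Finset.filter_union, Finset.card_union_of_disjoint
      (Finset.disjoint_filter_filter disjoint_compl_right)]
    push_cast; simp
  rw [h3]
  have hw := hW0 j i
  have m1 := min_le_left ((U.filter fun x => c x = j).card : ℝ) (Uᶜ.filter fun x => c x = j).card
  have m2 := min_le_right ((U.filter fun x => c x = j).card : ℝ) (Uᶜ.filter fun x => c x = j).card
  set μ := min ((U.filter fun x => c x = j).card : ℝ) (Uᶜ.filter fun x => c x = j).card
  have k1 : μ * ((U.filter fun x => c x = i).card * W j i) ≤
      (Uᶜ.filter fun x => c x = j).card * ((U.filter fun x => c x = i).card * W j i) := by gcongr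
  have k2 : μ * ((Uᶜ.filter fun x => c x = i).card * W j i) ≤
      (U.filter fun x => c x = j).card * ((Uᶜ.filter fun x => c x = i).card * W j i) := by gcongr
  linarith

/-- Control of the volumes by the cut weights for a graph whose degrees are bounded in terms of
their expectations. -/
lemma min_blockVol_le [DecidableEq B] {E : Finset (Finset V)}
    (hp0 : ∀ e, e.card = M → 0 ≤ p e)
    (hp : ∀ (σ : Equiv.Perm V), (∀ z, c (σ z) = c z) →
      ∀ e, e.card = M → p (e.map σ.toEmbedding) = p e) {s : ℝ} (hs : 0 ≤ s)
    (hdeg : ∀ x i, (blockDeg E c i x : ℝ) ≤ 2 * meanBlockDeg M p c i x + s) (U : Finset V)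
    (i j : B) :
    min (blockVol E c i j U : ℝ) (blockVol E c i j Uᶜ) ≤
      4 * cutWeight M p U + U.card * s := by
  obtain ⟨W, hW0, hW⟩ := exists_pairWeight_eq hp0 hp
  have h1 : ∀ A : Finset V, (blockVol E c i j A : ℝ) ≤ (A.filter fun x => c x = j).card *
      (2 * ((Finset.univ.filter fun y => c y = i).card * W j i) + s) := by
    intro A
    unfold blockVol
    push_cast
    rw [← nsmul_eq_mul]
    refine Finset.sum_le_card_nsmul _ _ _ fun x hx => (hdeg x i).trans ?_
    have := meanBlockDeg_le hp0 hW0 hW i x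
    rw [(Finset.mem_filter.1 hx).2] at this
    linarith
  have h2 := min_card_mul_le_cutWeight hp0 hW0 hW U i j
  have h3 : min ((U.filter fun x => c x = j).card : ℝ) (Uᶜ.filter fun x => c x = j).card ≤
      U.card :=
    (min_le_left _ _).trans (by exact_mod_cast Finset.card_filter_le _ _)
  have hnn : 0 ≤ 2 * ((Finset.univ.filter fun y => c y = i).card * W j i) + s := by
    have := hW0 j i
    positivity
  refine (min_le_min (h1 U) (h1 Uᶜ)).trans ?_
  rw [← min_mul_of_nonneg _ _ hnn]
  nlinarith

end ExpectedCounts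

/-! ### Chernoff bounds for independent events. -/

section Chernoff

variable {Ω ι : Type*} [MeasurableSpace Ω] {P : Measure Ω} [IsProbabilityMeasure P]

lemma mgf_indicator {s : Set Ω} (hs : MeasurableSet s) (θ : ℝ) :
    mgf (s.indicator fun _ => (1 : ℝ)) P θ = 1 + P.real s * (Real.exp θ - 1) := by
  have h : (fun x => Real.exp (θ * s.indicator (fun _ => (1 : ℝ)) x)) =
      fun x => 1 + s.indicator (fun _ => Real.exp θ - 1) x := by
    funext x
    by_cases hx : x ∈ s <;> simp [hx]
  rw [mgf, h, integral_add (integrable_const _) ((integrable_const _).indicator hs),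
    integral_indicator_const _ hs]
  simp

lemma mgf_sum_indicator_le {s : ι → Set Ω} (hs : ∀ i, MeasurableSet (s i)) (hind : iIndepSet s P)
    (A : Finset ι) (θ : ℝ) :
    mgf (∑ i ∈ A, (s i).indicator fun _ => (1 : ℝ)) P θ ≤
      Real.exp ((Real.exp θ - 1) * ∑ i ∈ A, P.real (s i)) := by
  rw [(hind.iIndepFun_indicator (β := ℝ)).mgf_sum
    (fun i => measurable_const.indicator (hs i)) A, Finset.mul_sum, Real.exp_sum]
  refine Finset.prod_le_prod (fun i _ => mgf_nonneg) fun i _ => ?_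
  have := mgf_indicator (P := P) (hs i) θ
  rw [this]
  refine le_trans ?_ (Real.add_one_le_exp _)
  linarith

lemma integrable_exp_sum_indicator {s : ι → Set Ω} (hs : ∀ i, MeasurableSet (s i))
    (A : Finset ι) (θ : ℝ) :
    Integrable (fun x => Real.exp (θ * (∑ i ∈ A, (s i).indicator fun _ => (1 : ℝ)) x)) P := by
  have hm : Measurable (∑ i ∈ A, (s i).indicator fun _ => (1 : ℝ)) := by
    simpa only [Finset.sum_fn] using Finset.measurable_sum A fun i _ =>
      (measurable_const (a := (1 : ℝ))).indicator (hs i)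
  refine Integrable.of_bound (by fun_prop) (Real.exp (|θ| * A.card)) (ae_of_all _ fun x => ?_)
  rw [Real.norm_eq_abs, Real.abs_exp, Real.exp_le_exp]
  have h0 : 0 ≤ (∑ i ∈ A, (s i).indicator fun _ => (1 : ℝ)) x := by
    rw [Finset.sum_apply]
    exact Finset.sum_nonneg fun i _ => Set.indicator_nonneg (fun _ _ => zero_le_one) x
  have h1 : (∑ i ∈ A, (s i).indicator fun _ => (1 : ℝ)) x ≤ A.card := by
    rw [Finset.sum_apply, ← nsmul_one]
    exact Finset.sum_le_card_nsmul _ _ _ fun i _ => Set.indicator_le_self' (fun _ _ => zero_le_one) x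
  calc θ * _ ≤ |θ| * _ := mul_le_mul_of_nonneg_right (le_abs_self θ) h0
    _ ≤ _ := by gcongr

/-- The exponential moment at `1` is enough, since `exp 1 - 1 ≤ 2`. -/
lemma measureReal_sum_indicator_ge_le {s : ι → Set Ω} (hs : ∀ i, MeasurableSet (s i))
    (hind : iIndepSet s P) (A : Finset ι) (r : ℝ) :
    P.real {x | 2 * ∑ i ∈ A, P.real (s i) + r ≤
      (∑ i ∈ A, (s i).indicator fun _ => (1 : ℝ)) x} ≤ Real.exp (-r) := by
  refine (measure_ge_le_exp_mul_mgf _ zero_le_one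
    (integrable_exp_sum_indicator hs A 1)).trans ?_
  refine (mul_le_mul_of_nonneg_left (mgf_sum_indicator_le hs hind A 1)
    (Real.exp_pos _).le).trans ?_
  rw [← Real.exp_add, Real.exp_le_exp]
  have : 0 ≤ ∑ i ∈ A, P.real (s i) := Finset.sum_nonneg fun _ _ => measureReal_nonneg
  nlinarith [Real.exp_one_lt_d9]

/-- The exponential moment at `-1`: with `exp (-1) ≤ 0.4` the exponent is at most `1/2 - 3/5 =
-1/10` times the mean. -/
lemma measureReal_sum_indicator_le_le {s : ι → Set Ω} (hs : ∀ i, MeasurableSet (s i))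
    (hind : iIndepSet s P) (A : Finset ι) :
    P.real {x | (∑ i ∈ A, (s i).indicator fun _ => (1 : ℝ)) x ≤ (∑ i ∈ A, P.real (s i)) / 2} ≤
      Real.exp (-(∑ i ∈ A, P.real (s i)) / 10) := by
  refine (measure_le_le_exp_mul_mgf _ (by norm_num : (-1 : ℝ) ≤ 0)
    (integrable_exp_sum_indicator hs A (-1))).trans ?_
  refine (mul_le_mul_of_nonneg_left (mgf_sum_indicator_le hs hind A (-1))
    (Real.exp_pos _).le).trans ?_
  rw [← Real.exp_add, Real.exp_le_exp]
  have h0 : 0 ≤ ∑ i ∈ A, P.real (s i) := Finset.sum_nonneg fun _ _ => measureReal_nonneg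
  have h1 : Real.exp (-1) ≤ 0.4 := by
    rw [Real.exp_neg, inv_le_comm₀ (Real.exp_pos _) (by norm_num)]
    linarith [Real.exp_one_gt_d9]
  nlinarith

end Chernoff

/-! ### Hoeffding's inequality for rankings, conditionally on the graph. -/

section Hoeffding

/-- The chord of the exponential over `[-θ b, θ b]` lies above it; after averaging a centred `g`
only the `cosh` term survives. -/
lemma exp_mul_le_cosh_add {b g : ℝ} (hb : 0 < b) (hg : |g| ≤ b) (θ : ℝ) :
    Real.exp (θ * g) ≤ Real.cosh (θ * b) + g * (Real.sinh (θ * b) / b) := by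
  obtain ⟨h1, h2⟩ := abs_le.1 hg
  have hconv := convexOn_exp.2 (Set.mem_univ (θ * b)) (Set.mem_univ (-(θ * b)))
    (show 0 ≤ (b + g) / (2 * b) from div_nonneg (by linarith) (by linarith))
    (show 0 ≤ (b - g) / (2 * b) from div_nonneg (by linarith) (by linarith))
    (by field_simp; ring)
  simp only [smul_eq_mul] at hconv
  have e1 : (b + g) / (2 * b) * (θ * b) + (b - g) / (2 * b) * -(θ * b) = θ * g := by
    field_simp; ring
  rw [e1] at hconv
  refine hconv.trans (le_of_eq ?_)
  rw [Real.cosh_eq, Real.sinh_eq]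
  field_simp
  ring

lemma sum_mul_exp_le {R : Type*} [Fintype R] {m g : R → ℝ} (hm : ∀ r, 0 ≤ m r)
    (hm1 : ∑ r, m r = 1) {b : ℝ} (hb : 0 < b) (hg : ∀ r, |g r| ≤ b)
    (hmean : ∑ r, m r * g r = 0) (θ : ℝ) :
    ∑ r, m r * Real.exp (θ * g r) ≤ Real.exp (θ ^ 2 * b ^ 2 / 2) := by
  calc ∑ r, m r * Real.exp (θ * g r)
      ≤ ∑ r, m r * (Real.cosh (θ * b) + g r * (Real.sinh (θ * b) / b)) :=
        Finset.sum_le_sum fun r _ =>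
          mul_le_mul_of_nonneg_left (exp_mul_le_cosh_add hb (hg r) θ) (hm r)
    _ = Real.cosh (θ * b) := by
        simp only [mul_add, Finset.sum_add_distrib, ← Finset.sum_mul, hm1, ← mul_assoc, hmean]
        ring
    _ ≤ Real.exp (θ ^ 2 * b ^ 2 / 2) := by
        rw [← mul_pow]; exact Real.cosh_le_exp_half_sq _

variable {Ω : Type*} [MeasurableSpace Ω] {P : Measure Ω} [IsProbabilityMeasure P] {n : ℕ}
  {u : Fin n → ℝ} {E : Ω → Finset (Finset (Fin n))}
  {π : Ω → (e : Finset (Fin n)) → Ranking e}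

/-- All the ways to rank the edges of `F`, with a fixed ranking for the other sets. -/
noncomputable def rankingChoices (F : Finset (Finset (Fin n))) (e : Finset (Fin n)) :
    Finset (Ranking e) :=
  if e ∈ F then Finset.univ else {e.equivFin.symm}

lemma sum_rankingChoices_prod (F : Finset (Finset (Fin n)))
    (f : (e : Finset (Fin n)) → Ranking e → ℝ) :
    ∑ σ ∈ Fintype.piFinset (rankingChoices F), ∏ e ∈ F, f e (σ e) = ∏ e ∈ F, ∑ r, f e r := by
  have h := Finset.prod_univ_sum (rankingChoices F)
    (fun e r => if e ∈ F then f e r else (1 : ℝ))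
  have h1 : ∀ e, ∑ r ∈ rankingChoices F e, (if e ∈ F then f e r else (1 : ℝ)) =
      if e ∈ F then ∑ r, f e r else 1 := by
    intro e
    unfold rankingChoices
    split_ifs <;> simp
  simp only [h1, Finset.prod_ite_mem, Finset.univ_inter] at h
  exact h.symm

/-- Conditionally on the edge set, sums of centred statistics of the rankings are
sub-Gaussian. -/
lemma measureReal_sum_ranking_gt_le (hπ : IsPLData P u E π) (F : Finset (Finset (Fin n)))
    {F' : Finset (Finset (Fin n))} (hF' : F' ⊆ F) (g : (e : Finset (Fin n)) → Ranking e → ℝ)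
    {b : ℝ} (hb : 0 < b) (hg : ∀ e ∈ F', ∀ r, |g e r| ≤ b)
    (hmean : ∀ e ∈ F', ∑ r, plMass u r * g e r = 0) {θ : ℝ} (hθ : 0 ≤ θ) (τ : ℝ) :
    P.real {x | E x = F ∧ τ < ∑ e ∈ F', g e (π x e)} ≤
      P.real {x | E x = F} * Real.exp (F'.card * (θ ^ 2 * b ^ 2 / 2) - θ * τ) := by
  classical
  set f : (e : Finset (Fin n)) → Ranking e → ℝ := fun e r =>
    plMass u r * if e ∈ F' then Real.exp (θ * g e r) else 1 with hf
  -- The event is covered by finitely many joint outcomes of graph and rankings, whose probabilities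
  -- are given by `law`. Freezing the rankings off `F` counts each outcome on `F` once.
  have hsub : {x | E x = F ∧ τ < ∑ e ∈ F', g e (π x e)} ⊆
      ⋃ σ ∈ (Fintype.piFinset (rankingChoices F)).filter fun σ => τ < ∑ e ∈ F', g e (σ e),
        {x | E x = F ∧ ∀ e ∈ F, π x e = σ e} := by
    rintro x ⟨hx, hτ⟩
    simp only [Set.mem_iUnion, Finset.mem_filter, Fintype.mem_piFinset]
    refine ⟨fun e => if e ∈ F then π x e else e.equivFin.symm, ⟨fun e => ?_, ?_⟩, hx,
      fun e he => by simp [he]⟩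
    · unfold rankingChoices
      by_cases h : e ∈ F <;> simp [h]
    · refine hτ.trans_le (le_of_eq (Finset.sum_congr rfl fun e he => ?_))
      simp [hF' he]
  refine (measureReal_mono hsub (measure_ne_top _ _)).trans
    ((measureReal_biUnion_finset_le _ _).trans ?_)
  -- The exponential Markov inequality, applied outcome by outcome.
  have hterm : ∀ σ : (e : Finset (Fin n)) → Ranking e, τ < ∑ e ∈ F', g e (σ e) →
      P.real {x | E x = F ∧ ∀ e ∈ F, π x e = σ e} ≤
        P.real {x | E x = F} * Real.exp (- (θ * τ)) * ∏ e ∈ F, f e (σ e) := by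
    intro σ hσ
    rw [hπ.law, mul_assoc]
    refine mul_le_mul_of_nonneg_left ?_ measureReal_nonneg
    have hprod : ∏ e ∈ F, f e (σ e) =
        (∏ e ∈ F, plMass u (σ e)) * Real.exp (θ * ∑ e ∈ F', g e (σ e)) := by
      simp only [hf, Finset.prod_mul_distrib]
      congr 1
      rw [Finset.prod_ite_mem, Finset.inter_eq_right.2 hF', Finset.mul_sum, Real.exp_sum]
    rw [hprod, mul_left_comm, ← Real.exp_add]
    refine le_mul_of_one_le_right (Finset.prod_nonneg fun e _ => plMass_nonneg u _) ?_
    rw [Real.one_le_exp_iff]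
    nlinarith
  refine (Finset.sum_le_sum fun σ hσ => hterm σ (Finset.mem_filter.1 hσ).2).trans ?_
  have hf0 : ∀ e r, 0 ≤ f e r := fun e r => by
    refine mul_nonneg (plMass_nonneg u r) ?_
    split_ifs
    · exact (Real.exp_pos _).le
    · exact zero_le_one
  refine (Finset.sum_le_sum_of_subset_of_nonneg (Finset.filter_subset _ _) fun σ _ _ =>
    mul_nonneg (mul_nonneg measureReal_nonneg (Real.exp_pos _).le)
      (Finset.prod_nonneg fun e _ => hf0 _ _)).trans ?_
  rw [← Finset.mul_sum, sum_rankingChoices_prod, mul_assoc, sub_eq_neg_add, Real.exp_add]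
  refine mul_le_mul_of_nonneg_left (mul_le_mul_of_nonneg_left ?_ (Real.exp_pos _).le)
    measureReal_nonneg
  calc ∏ e ∈ F, ∑ r, f e r ≤ ∏ e ∈ F, if e ∈ F' then Real.exp (θ ^ 2 * b ^ 2 / 2) else 1 := by
        refine Finset.prod_le_prod (fun e _ => Finset.sum_nonneg fun r _ => hf0 e r)
          fun e _ => ?_
        by_cases he : e ∈ F'
        · simp only [hf, he, if_true]
          exact sum_mul_exp_le (fun r => plMass_nonneg u r) (sum_plMass u e) hb (hg e he)
            (hmean e he) θ
        · simp only [hf, he, if_false, mul_one]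
          exact (sum_plMass u e).le
    _ = Real.exp (F'.card * (θ ^ 2 * b ^ 2 / 2)) := by
        rw [Finset.prod_ite_mem, Finset.inter_eq_right.2 hF', Finset.prod_const, ← Real.exp_nat_mul]

lemma sum_measureReal_eq_le_one (hE : ∀ F, MeasurableSet {x | E x = F})
    (s : Finset (Finset (Finset (Fin n)))) : ∑ F ∈ s, P.real {x | E x = F} ≤ 1 := by
  rw [← measureReal_biUnion_finset (fun F _ F' _ hne => by
    refine Set.disjoint_left.2 fun x hx hx' => hne ?_
    exact (hx : E x = F).symm.trans hx') fun F _ => hE F]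
  exact measureReal_le_one

/-- The tail bound for the sums of centred statistics over the edges that cross `U`. -/
lemma measureReal_score_gt_le (hE : ∀ F, MeasurableSet {x | E x = F}) (hπ : IsPLData P u E π)
    (U : Finset (Fin n))
    (g : Finset (Finset (Fin n)) → (e : Finset (Fin n)) → Ranking e → ℝ)
    {b : ℝ} (hb : 0 < b) (hg : ∀ F, (∃ x, E x = F) → ∀ e ∈ F, ∀ r, |g F e r| ≤ b)
    (hmean : ∀ F, (∃ x, E x = F) → ∀ e ∈ F, ∑ r, plMass u r * g F e r = 0) {q : ℝ} (hq : 0 ≤ q) :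
    P.real {x | b * Real.sqrt (8 * ((edgeCut (E x) U).card * q)) <
      ∑ e ∈ edgeCut (E x) U, g (E x) e (π x e)} ≤ Real.exp (-4 * q) := by
  classical
  have hsub : {x | b * Real.sqrt (8 * ((edgeCut (E x) U).card * q)) <
      ∑ e ∈ edgeCut (E x) U, g (E x) e (π x e)} ⊆
      -- The statistic may depend on the graph, so the union is over graphs; only attained ones are
      -- kept, because the hypotheses on `g` cover no others.
      ⋃ F ∈ Finset.univ.filter fun F => ∃ x, E x = F,
        {x | E x = F ∧ b * Real.sqrt (8 * ((edgeCut F U).card * q)) <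
          ∑ e ∈ edgeCut F U, g F e (π x e)} := by
    intro x hx
    simp only [Set.mem_iUnion, Finset.mem_filter, Finset.mem_univ, true_and]
    exact ⟨E x, ⟨x, rfl⟩, rfl, hx⟩
  refine (measureReal_mono hsub (measure_ne_top _ _)).trans
    ((measureReal_biUnion_finset_le _ _).trans ?_)
  have hF : ∀ F ∈ Finset.univ.filter fun F => ∃ x, E x = F,
      P.real {x | E x = F ∧ b * Real.sqrt (8 * ((edgeCut F U).card * q)) <
          ∑ e ∈ edgeCut F U, g F e (π x e)} ≤ P.real {x | E x = F} * Real.exp (-4 * q) := by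
    intro F hF
    have hF := (Finset.mem_filter.1 hF).2
    have hcs : edgeCut F U ⊆ F := edgeCut_subset F U
    rcases Nat.eq_zero_or_pos (edgeCut F U).card with h0 | h0
    -- For an empty cut both sides vanish, and the strict inequality makes the event empty.
    · rw [Finset.card_eq_zero] at h0
      simp only [h0, Finset.card_empty, Finset.sum_empty, Nat.cast_zero, zero_mul, mul_zero,
        Real.sqrt_zero, lt_irrefl, and_false, Set.ofPred_false, measureReal_empty]
      exact mul_nonneg measureReal_nonneg (Real.exp_pos _).le
    · have hN : (0 : ℝ) < (edgeCut F U).card := by exact_mod_cast h0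
      set N : ℝ := ((edgeCut F U).card : ℝ)
      set τ := Real.sqrt (8 * (N * q)) with hτ
      have hτ2 : τ ^ 2 = 8 * (N * q) := Real.sq_sqrt (by positivity)
      -- This `θ` minimizes the exponent, which becomes `-τ ^ 2 / (2 * N) = -4 * q`.
      refine (measureReal_sum_ranking_gt_le hπ F hcs (g F) hb (fun e he => hg F hF e (hcs he))
        (fun e he => hmean F hF e (hcs he)) (θ := τ / (b * N)) (by positivity) (b * τ)).trans
        (le_of_eq ?_)
      congr 2
      have e1 : N * ((τ / (b * N)) ^ 2 * b ^ 2 / 2) - τ / (b * N) * (b * τ) =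
          - (τ ^ 2 / (2 * N)) := by
        field_simp; ring
      change N * ((τ / (b * N)) ^ 2 * b ^ 2 / 2) - τ / (b * N) * (b * τ) = _
      rw [e1, hτ2]
      field_simp; ring
  refine (Finset.sum_le_sum hF).trans ?_
  rw [← Finset.sum_mul]
  exact mul_le_of_le_one_left (Real.exp_pos _).le (sum_measureReal_eq_le_one hE _)

lemma measureReal_abs_score_gt_le (hE : ∀ F, MeasurableSet {x | E x = F})
    (hπ : IsPLData P u E π) (U : Finset (Fin n))
    (g : Finset (Finset (Fin n)) → (e : Finset (Fin n)) → Ranking e → ℝ)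
    {b : ℝ} (hb : 0 < b) (hg : ∀ F, (∃ x, E x = F) → ∀ e ∈ F, ∀ r, |g F e r| ≤ b)
    (hmean : ∀ F, (∃ x, E x = F) → ∀ e ∈ F, ∑ r, plMass u r * g F e r = 0) {q : ℝ} (hq : 0 ≤ q) :
    P.real {x | b * Real.sqrt (8 * ((edgeCut (E x) U).card * q)) <
      |∑ e ∈ edgeCut (E x) U, g (E x) e (π x e)|} ≤ 2 * Real.exp (-4 * q) := by
  have h1 := measureReal_score_gt_le hE hπ U g hb hg hmean hq
  have h2 := measureReal_score_gt_le hE hπ U (fun F e r => - g F e r) hb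
    (fun F hF e he r => by rw [abs_neg]; exact hg F hF e he r)
    (fun F hF e he => by simp [hmean F hF e he]) hq
  have hsub : {x | b * Real.sqrt (8 * ((edgeCut (E x) U).card * q)) <
      |∑ e ∈ edgeCut (E x) U, g (E x) e (π x e)|} ⊆
      {x | b * Real.sqrt (8 * ((edgeCut (E x) U).card * q)) <
        ∑ e ∈ edgeCut (E x) U, g (E x) e (π x e)} ∪
      {x | b * Real.sqrt (8 * ((edgeCut (E x) U).card * q)) <
        ∑ e ∈ edgeCut (E x) U, - g (E x) e (π x e)} := by
    intro x hx
    rw [Set.mem_ofPred_eq] at hx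
    rcases lt_abs.1 hx with h | h
    · exact Or.inl h
    · right
      simpa [Finset.sum_neg_distrib] using h
  refine (measureReal_mono hsub (measure_ne_top _ _)).trans ((measureReal_union_le _ _).trans ?_)
  linarith

end Hoeffding

/-! ### The two estimators as choice models. -/

section RankingModels

variable {n : ℕ}

/-- A ranking as an embedding of the positions into all the objects. -/
def rankingEmb {e : Finset (Fin n)} (r : Ranking e) : Fin e.card ↪ Fin n :=
  r.toEmbedding.trans (Function.Embedding.subtype _)

lemma rankingEmb_apply {e : Finset (Fin n)} (r : Ranking e) (j : Fin e.card) :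
    rankingEmb r j = r j := rfl

lemma rankingEmb_mem {e : Finset (Fin n)} (r : Ranking e) (j : Fin e.card) :
    rankingEmb r j ∈ e := (r j).2

lemma exists_rankingEmb_eq {e : Finset (Fin n)} (r : Ranking e) {x : Fin n} (hx : x ∈ e) :
    ∃ j, rankingEmb r j = x :=
  ⟨r.symm ⟨x, hx⟩, by simp [rankingEmb_apply]⟩

/-- The successive choices of the top `y` objects in a ranking of `e`, as a sum of centred
indicators of `U`. -/
noncomputable def marginalEdgeScore (y : ℕ) (U : Finset (Fin n)) (u : Fin n → ℝ)
    {e : Finset (Fin n)} (r : Ranking e) : ℝ :=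
  ∑ j : Fin e.card with j.val < y, ((if rankingEmb r j ∈ U then 1 else 0) -
    softMass u ((Finset.Ici j).map (rankingEmb r)) U)

/-- The pairwise comparisons in a ranking of `e`, as a sum of centred indicators of `U`. -/
noncomputable def quasiEdgeScore (U : Finset (Fin n)) (u : Fin n → ℝ)
    {e : Finset (Fin n)} (r : Ranking e) : ℝ :=
  ∑ a : Fin e.card × Fin e.card with a.1 < a.2, ((if rankingEmb r a.1 ∈ U then 1 else 0) -
    softMass u {rankingEmb r a.1, rankingEmb r a.2} U)

/-- The choice model of the top positions of the rankings. -/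
def marginalModel (E : Finset (Finset (Fin n))) (π : (e : Finset (Fin n)) → Ranking e)
    (y : Finset (Fin n) → ℕ) (hy : ∀ e ∈ E, 1 ≤ y e) : ChoiceModel E where
  κ e := Fin e.card
  terms e := Finset.univ.filter fun j => j.val < y e
  set e j := (Finset.Ici j).map (rankingEmb (π e))
  chosen e j := rankingEmb (π e) j
  chosen_mem e _ j _ := by simp
  set_subset e _ j _ := by
    intro x hx
    obtain ⟨t, -, rfl⟩ := Finset.mem_map.1 hx
    exact rankingEmb_mem _ _
  exists_crosses e he U hc := by
    obtain ⟨⟨a, hae, haU⟩, b, hbe, hbU⟩ := hc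
    have hpos : 0 < e.card := Finset.card_pos.2 ⟨a, hae⟩
    -- The first choice is made from the whole edge, so it is mixed whenever the edge crosses; this
    -- is why at least one position must be observed.
    have hmem : ∀ x ∈ e, x ∈ (Finset.Ici (⟨0, hpos⟩ : Fin e.card)).map (rankingEmb (π e)) := by
      intro x hx
      obtain ⟨j, rfl⟩ := exists_rankingEmb_eq (π e) hx
      exact Finset.mem_map_of_mem _ (Finset.mem_Ici.2 (Nat.zero_le _))
    exact ⟨⟨0, hpos⟩, Finset.mem_filter.2 ⟨Finset.mem_univ _, hy e he⟩, ⟨a, hmem a hae, haU⟩, b, hmem b hbe, hbU⟩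

/-- The choice model of the pairwise comparisons in the rankings. -/
def quasiModel (E : Finset (Finset (Fin n))) (π : (e : Finset (Fin n)) → Ranking e) :
    ChoiceModel E where
  κ e := Fin e.card × Fin e.card
  terms e := Finset.univ.filter fun a => a.1 < a.2
  set e a := {rankingEmb (π e) a.1, rankingEmb (π e) a.2}
  chosen e a := rankingEmb (π e) a.1
  chosen_mem e _ a _ := by simp
  set_subset e _ a _ := by
    intro x hx
    rcases Finset.mem_insert.1 hx with rfl | hx
    · exact rankingEmb_mem _ _
    · rw [Finset.mem_singleton.1 hx]; exact rankingEmb_mem _ _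
  exists_crosses e he U hc := by
    obtain ⟨⟨a, hae, haU⟩, b, hbe, hbU⟩ := hc
    obtain ⟨i, rfl⟩ := exists_rankingEmb_eq (π e) hae
    obtain ⟨j, rfl⟩ := exists_rankingEmb_eq (π e) hbe
    rcases lt_trichotomy i j with h | h | h
    · exact ⟨(i, j), by simpa using h, ⟨_, by simp, haU⟩, _, by simp, hbU⟩
    · subst h; exact absurd haU hbU
    · exact ⟨(j, i), by simpa using h, ⟨rankingEmb (π e) i, by simp, haU⟩,
        rankingEmb (π e) j, by simp, hbU⟩

lemma logLik_marginalModel (E : Finset (Finset (Fin n)))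
    (π : (e : Finset (Fin n)) → Ranking e) (y : Finset (Fin n) → ℕ) (hy : ∀ e ∈ E, 1 ≤ y e) :
    (marginalModel E π y hy).logLik = marginalLogLik E π y := by
  funext u
  simp [ChoiceModel.logLik, marginalLogLik, marginalModel, rankingEmb_apply]

lemma logLik_quasiModel (E : Finset (Finset (Fin n)))
    (π : (e : Finset (Fin n)) → Ranking e) :
    (quasiModel E π).logLik = quasiLogLik E π := by
  funext u
  simp only [ChoiceModel.logLik, quasiLogLik, quasiModel]
  refine Finset.sum_congr rfl fun e _ => ?_
  rw [Finset.sum_filter, Fintype.sum_prod_type]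
  refine Finset.sum_congr rfl fun j _ => ?_
  rw [← Finset.sum_filter]
  have : Finset.univ.filter (fun t => j < t) = Finset.Ioi j := by ext; simp
  rw [this]
  refine Finset.sum_congr rfl fun t ht => ?_
  rw [Finset.sum_pair fun h =>
    (Finset.mem_Ioi.1 ht).ne ((rankingEmb (π e)).injective h)]
  rfl

lemma abs_indicator_sub_softMass_le (u : Fin n → ℝ) (A U : Finset (Fin n)) (a : Fin n) :
    |(if a ∈ U then 1 else 0) - softMass u A U| ≤ 1 := by
  have h0 := softMass_nonneg u A U
  have h1 := softMass_le_one u A U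
  rw [abs_le]
  split_ifs <;> constructor <;> linarith

lemma abs_marginalEdgeScore_le (y : ℕ) (U : Finset (Fin n)) (u : Fin n → ℝ)
    {e : Finset (Fin n)} (r : Ranking e) : |marginalEdgeScore y U u r| ≤ (e.card : ℝ) ^ 2 := by
  refine (Finset.abs_sum_le_sum_abs _ _).trans ((Finset.sum_le_card_nsmul _ _ 1 fun j _ =>
    abs_indicator_sub_softMass_le u _ U _).trans ?_)
  rw [nsmul_one]
  have h1 : (Finset.univ.filter fun j : Fin e.card => j.val < y).card ≤ e.card :=
    (Finset.card_filter_le _ _).trans (by simp)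
  exact_mod_cast h1.trans (Nat.le_self_pow two_ne_zero _)

lemma abs_quasiEdgeScore_le (U : Finset (Fin n)) (u : Fin n → ℝ)
    {e : Finset (Fin n)} (r : Ranking e) : |quasiEdgeScore U u r| ≤ (e.card : ℝ) ^ 2 := by
  refine (Finset.abs_sum_le_sum_abs _ _).trans ((Finset.sum_le_card_nsmul _ _ 1 fun j _ =>
    abs_indicator_sub_softMass_le u _ U _).trans ?_)
  rw [nsmul_one]
  have h1 : (Finset.univ.filter fun a : Fin e.card × Fin e.card => a.1 < a.2).card ≤
      e.card ^ 2 := (Finset.card_filter_le _ _).trans (by simp [sq])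
  exact_mod_cast h1

lemma sum_plMass_mul_marginalEdgeScore (y : ℕ) (U : Finset (Fin n)) (u : Fin n → ℝ)
    (e : Finset (Fin n)) : ∑ r : Ranking e, plMass u r * marginalEdgeScore y U u r = 0 := by
  simp only [marginalEdgeScore, Finset.mul_sum]
  rw [Finset.sum_comm]
  refine Finset.sum_eq_zero fun j _ => ?_
  refine Eq.trans (Finset.sum_congr rfl fun r _ => ?_)
    (sum_plMass_mul_choice u e (fun x => if x ∈ U then 1 else 0) j)
  rw [softMass, Finset.sum_filter, Finset.sum_map, Finset.sum_map]
  simp only [rankingEmb_apply, mul_ite, mul_one, mul_zero]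
  congr!

lemma sum_plMass_mul_quasiEdgeScore (U : Finset (Fin n)) (u : Fin n → ℝ)
    (e : Finset (Fin n)) : ∑ r : Ranking e, plMass u r * quasiEdgeScore U u r = 0 := by
  refine Eq.trans (Finset.sum_congr rfl fun r _ => ?_)
    (sum_plMass_mul_pairs u e (fun x => if x ∈ U then 1 else 0))
  congr 1
  rw [quasiEdgeScore, Finset.sum_filter, Fintype.sum_prod_type]
  refine Finset.sum_congr rfl fun j _ => ?_
  rw [← Finset.sum_filter]
  have : Finset.univ.filter (fun t => j < t) = Finset.Ioi j := by ext; simp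
  rw [this]
  refine Finset.sum_congr rfl fun t ht => ?_
  have hne : rankingEmb r j ≠ rankingEmb r t := fun h =>
    (Finset.mem_Ioi.1 ht).ne ((rankingEmb r).injective h)
  rw [softMass, Finset.sum_filter, Finset.sum_pair hne, Finset.sum_pair hne]
  simp only [rankingEmb_apply, mul_ite, mul_one, mul_zero]
  congr!

end RankingModels

/-! ### Edge counts in the hypergraph stochastic block model. -/

section BlockModel

variable {Ω : Type*} [MeasurableSpace Ω] {P : Measure Ω} {M K n : ℕ}
  {c : Fin n → Fin K} {ω : Fin (K + 1) → ℝ} {E : Ω → Finset (Finset (Fin n))}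

namespace IsHSBM

lemma measurableSet_mem (h : IsHSBM P M c ω E) (e : Finset (Fin n)) :
    MeasurableSet {x | e ∈ E x} := by
  have : {x | e ∈ E x} = ⋃ F ∈ {F : Finset (Finset (Fin n)) | e ∈ F}, {x | E x = F} := by
    ext x; simp
  rw [this]
  exact MeasurableSet.biUnion (Set.to_countable _) fun F _ => h.measurableSet_eq F

lemma prob_eq (h : IsHSBM P M c ω E) {e : Finset (Fin n)} (he : e.card = M) :
    ∃ i, P.real {x | e ∈ E x} = ω i := by
  by_cases hc : ∃ i : Fin K, ∀ v ∈ e, c v = i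
  · obtain ⟨i, hi⟩ := hc
    exact ⟨_, h.prob_within i e he hi⟩
  · push Not at hc
    exact ⟨0, h.prob_across e he fun i hi => by
      obtain ⟨v, hv, hne⟩ := hc i; exact hne (hi v hv)⟩

lemma inf_le_prob (h : IsHSBM P M c ω E) {e : Finset (Fin n)} (he : e.card = M) :
    Finset.univ.inf' Finset.univ_nonempty ω ≤ P.real {x | e ∈ E x} := by
  obtain ⟨i, hi⟩ := h.prob_eq he
  rw [hi]
  exact Finset.inf'_le _ (Finset.mem_univ i)

/-- A label-preserving permutation neither creates nor destroys containment in a block. This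
symmetry makes expected pair counts depend on labels only. -/
lemma prob_map (h : IsHSBM P M c ω E) (σ : Equiv.Perm (Fin n)) (hσ : ∀ z, c (σ z) = c z)
    (e : Finset (Fin n)) (he : e.card = M) :
    P.real {x | e.map σ.toEmbedding ∈ E x} = P.real {x | e ∈ E x} := by
  have hcard : (e.map σ.toEmbedding).card = M := by rw [Finset.card_map, he]
  have hiff : ∀ i, (∀ v ∈ e.map σ.toEmbedding, c v = i) ↔ ∀ v ∈ e, c v = i := by
    intro i
    rw [Finset.forall_mem_map]
    simp only [Equiv.coe_toEmbedding, hσ]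
  by_cases hc : ∃ i : Fin K, ∀ v ∈ e, c v = i
  · obtain ⟨i, hi⟩ := hc
    rw [h.prob_within i e he hi, h.prob_within i _ hcard ((hiff i).2 hi)]
  · push Not at hc
    have h1 : ∀ i : Fin K, ¬ ∀ v ∈ e, c v = i := fun i hi => by
      obtain ⟨v, hv, hne⟩ := hc i; exact hne (hi v hv)
    rw [h.prob_across e he h1, h.prob_across _ hcard fun i hi => h1 i ((hiff i).1 hi)]

lemma sum_prob_eq (Q : Finset (Fin n) → Prop) [DecidablePred Q] (p : Finset (Fin n) → ℝ) :
    ∑ e : {e : Finset (Fin n) // e.card = M} with Q e.1, p e.1 =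
      ∑ e ∈ Finset.powersetCard M Finset.univ with Q e, p e := by
  rw [Finset.sum_filter, Finset.sum_filter]
  exact (Finset.sum_subtype (p := fun e : Finset (Fin n) => e.card = M)
    (Finset.powersetCard M Finset.univ) (by simp) (fun e => if Q e then p e else 0)).symm

lemma sum_indicator_eq (h : IsHSBM P M c ω E) (Q : Finset (Fin n) → Prop) [DecidablePred Q]
    (x : Ω) :
    (∑ e : {e : Finset (Fin n) // e.card = M} with Q e.1,
      {x | e.1 ∈ E x}.indicator fun _ => (1 : ℝ)) x = ((E x).filter Q).card := by
  rw [Finset.sum_apply]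
  have h1 : ∀ e : {e : Finset (Fin n) // e.card = M},
      ({x | e.1 ∈ E x}.indicator fun _ => (1 : ℝ)) x = if e.1 ∈ E x then 1 else 0 := by
    intro e
    simp [Set.indicator_apply]
  simp only [h1]
  rw [sum_prob_eq Q (fun e => if e ∈ E x then (1 : ℝ) else 0), Finset.sum_boole,
    Finset.filter_filter]
  congr 2
  ext e
  simp only [Finset.mem_filter, Finset.mem_powersetCard, Finset.subset_univ, true_and]
  exact ⟨fun ⟨_, hQ, he⟩ => ⟨he, hQ⟩, fun ⟨he, hQ⟩ => ⟨h.uniform x e he, hQ, he⟩⟩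

variable [IsProbabilityMeasure P]

lemma measureReal_card_ge_le (h : IsHSBM P M c ω E) (Q : Finset (Fin n) → Prop)
    [DecidablePred Q] (r : ℝ) :
    P.real {x | 2 * ∑ e ∈ Finset.powersetCard M Finset.univ with Q e, P.real {x | e ∈ E x} + r ≤
      ((E x).filter Q).card} ≤ Real.exp (-r) := by
  have := measureReal_sum_indicator_ge_le (fun e : {e : Finset (Fin n) // e.card = M} =>
    h.measurableSet_mem e.1) h.indep (Finset.univ.filter fun e => Q e.1) r
  simpa only [h.sum_indicator_eq, sum_prob_eq Q (fun e => P.real {x | e ∈ E x})] using this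

lemma measureReal_card_le_le (h : IsHSBM P M c ω E) (Q : Finset (Fin n) → Prop)
    [DecidablePred Q] :
    P.real {x | (((E x).filter Q).card : ℝ) ≤
      (∑ e ∈ Finset.powersetCard M Finset.univ with Q e, P.real {x | e ∈ E x}) / 2} ≤
      Real.exp (-(∑ e ∈ Finset.powersetCard M Finset.univ with Q e,
        P.real {x | e ∈ E x}) / 10) := by
  have := measureReal_sum_indicator_le_le (fun e : {e : Finset (Fin n) // e.card = M} =>
    h.measurableSet_mem e.1) h.indep (Finset.univ.filter fun e => Q e.1)
  simpa only [h.sum_indicator_eq, sum_prob_eq Q (fun e => P.real {x | e ∈ E x})] using this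

end IsHSBM

end BlockModel

/-! ### Union bounds over vertex sets. -/

section UnionBounds

lemma exp_neg_mul_log {n : ℕ} (hn : 0 < n) (k : ℕ) :
    Real.exp (-4 * (k * Real.log n)) = ((n : ℝ)⁻¹ ^ 4) ^ k := by
  have hn' : (0 : ℝ) < n := by exact_mod_cast hn
  rw [← pow_mul, ← Real.exp_log (inv_pos.2 hn'), ← Real.exp_nat_mul, Real.log_inv]
  push_cast
  ring_nf

/-- Each summand is `n ^ (-4 * k)` with `k ≥ 1`, hence at most `n⁻² * n ^ (-k)`; the binomial
theorem then leaves `(1 + 1 / n) ^ n ≤ 3`. -/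
lemma sum_exp_card_le {n : ℕ} (hn : 0 < n) :
    ∑ U : Finset (Fin n) with U.Nonempty, Real.exp (-4 * (U.card * Real.log n)) ≤
      3 / (n : ℝ) ^ 2 := by
  have hn' : (1 : ℝ) ≤ n := by exact_mod_cast hn
  have hi0 : (0 : ℝ) ≤ (n : ℝ)⁻¹ := by positivity
  have hi1 : (n : ℝ)⁻¹ ≤ 1 := inv_le_one_of_one_le₀ hn'
  have h1 : ∀ U ∈ Finset.univ.filter fun U : Finset (Fin n) => U.Nonempty,
      Real.exp (-4 * (U.card * Real.log n)) ≤
        (n : ℝ)⁻¹ ^ 2 * ((n : ℝ)⁻¹ ^ U.card * 1 ^ (Fintype.card (Fin n) - U.card)) := by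
    intro U hU
    have hc := Finset.card_pos.2 (Finset.mem_filter.1 hU).2
    rw [exp_neg_mul_log hn, ← pow_mul, one_pow, mul_one, ← pow_add]
    exact pow_le_pow_of_le_one hi0 hi1 (by omega)
  refine (Finset.sum_le_sum h1).trans ((Finset.sum_le_sum_of_subset_of_nonneg
    (Finset.filter_subset _ _) fun U _ _ => by positivity).trans ?_)
  rw [← Finset.mul_sum, Fintype.sum_pow_mul_eq_add_pow, Fintype.card_fin]
  have h2 : ((n : ℝ)⁻¹ + 1) ^ n ≤ 3 := by
    calc ((n : ℝ)⁻¹ + 1) ^ n ≤ Real.exp ((n : ℝ)⁻¹) ^ n := by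
          gcongr; exact Real.add_one_le_exp _
      _ = Real.exp 1 := by
          rw [← Real.exp_nat_mul, mul_inv_cancel₀ (by positivity)]
      _ ≤ 3 := by linarith [Real.exp_one_lt_d9]
  calc (n : ℝ)⁻¹ ^ 2 * ((n : ℝ)⁻¹ + 1) ^ n ≤ (n : ℝ)⁻¹ ^ 2 * 3 := by gcongr
    _ = 3 / (n : ℝ) ^ 2 := by rw [inv_pow]; ring

variable {Ω : Type*} [MeasurableSpace Ω] {P : Measure Ω} [IsProbabilityMeasure P] {M K n : ℕ}
  {c : Fin n → Fin K} {ω : Fin (K + 1) → ℝ} {E : Ω → Finset (Finset (Fin n))}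
  {u : Fin n → ℝ} {π : Ω → (e : Finset (Fin n)) → Ranking e}

lemma measureReal_exists_finset_le (hn : 0 < n) {A : Finset (Fin n) → Set Ω} {a : ℝ}
    (h : ∀ U : Finset (Fin n), U.Nonempty → 2 * U.card ≤ n →
      P.real (A U) ≤ a * Real.exp (-4 * (U.card * Real.log n))) (ha : 0 ≤ a) :
    P.real {x | ∃ U : Finset (Fin n), U.Nonempty ∧ 2 * U.card ≤ n ∧ x ∈ A U} ≤
      a * (3 / (n : ℝ) ^ 2) := by
  have hsub : {x | ∃ U : Finset (Fin n), U.Nonempty ∧ 2 * U.card ≤ n ∧ x ∈ A U} ⊆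
      ⋃ U ∈ Finset.univ.filter fun U : Finset (Fin n) => U.Nonempty ∧ 2 * U.card ≤ n, A U := by
    rintro x ⟨U, h1, h2, h3⟩
    simp only [Set.mem_iUnion, Finset.mem_filter, Finset.mem_univ, true_and]
    exact ⟨U, ⟨h1, h2⟩, h3⟩
  refine (measureReal_mono hsub (measure_ne_top _ _)).trans
    ((measureReal_biUnion_finset_le _ _).trans ?_)
  refine (Finset.sum_le_sum fun U hU => h U (Finset.mem_filter.1 hU).2.1
    (Finset.mem_filter.1 hU).2.2).trans ?_
  rw [← Finset.mul_sum]
  refine mul_le_mul_of_nonneg_left (le_trans ?_ (sum_exp_card_le hn)) ha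
  exact Finset.sum_le_sum_of_subset_of_nonneg
    (Finset.monotone_filter_right _ fun U _ (hU : U.Nonempty ∧ _) => hU.1)
    fun _ _ _ => (Real.exp_pos _).le

lemma IsHSBM.measureReal_edgeCut_le_le (h : IsHSBM P M c ω E) (U : Finset (Fin n)) :
    P.real {x | ((edgeCut (E x) U).card : ℝ) ≤ meanCut M (fun e => P.real {x | e ∈ E x}) U / 2} ≤
      Real.exp (-(meanCut M (fun e => P.real {x | e ∈ E x}) U) / 10) := by
  have := h.measureReal_card_le_le (fun e => Crosses e U)
  unfold meanCut edgeCut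
  convert this

lemma IsHSBM.measureReal_blockDeg_ge_le (h : IsHSBM P M c ω E) (i : Fin K) (v : Fin n) (r : ℝ) :
    P.real {x | 2 * meanBlockDeg M (fun e => P.real {x | e ∈ E x}) c i v + r ≤
      (blockDeg (E x) c i v : ℝ)} ≤ Real.exp (-r) := by
  have := h.measureReal_card_ge_le (fun e => v ∈ e ∧ ∃ y ∈ e, y ≠ v ∧ c y = i) r
  unfold meanBlockDeg blockDeg
  convert this

lemma IsHSBM.measureReal_exists_blockDeg_le (h : IsHSBM P M c ω E) (hn : 0 < n) :
    P.real {x | ∃ v i, 2 * meanBlockDeg M (fun e => P.real {x | e ∈ E x}) c i v +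
      4 * Real.log n ≤ (blockDeg (E x) c i v : ℝ)} ≤ K / (n : ℝ) ^ 2 := by
  have hsub : {x | ∃ v i, 2 * meanBlockDeg M (fun e => P.real {x | e ∈ E x}) c i v +
      4 * Real.log n ≤ (blockDeg (E x) c i v : ℝ)} ⊆
      ⋃ q ∈ (Finset.univ : Finset (Fin n × Fin K)),
        {x | 2 * meanBlockDeg M (fun e => P.real {x | e ∈ E x}) c q.2 q.1 +
          4 * Real.log n ≤ (blockDeg (E x) c q.2 q.1 : ℝ)} := by
    rintro x ⟨v, i, hx⟩
    simp only [Set.mem_iUnion]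
    exact ⟨(v, i), Finset.mem_univ _, hx⟩
  refine (measureReal_mono hsub (measure_ne_top _ _)).trans
    ((measureReal_biUnion_finset_le _ _).trans ?_)
  refine (Finset.sum_le_card_nsmul _ _ _ fun q _ =>
    h.measureReal_blockDeg_ge_le q.2 q.1 (4 * Real.log n)).trans ?_
  have h1 := exp_neg_mul_log hn 1
  rw [Nat.cast_one, one_mul, pow_one] at h1
  rw [← neg_mul, h1]
  have hn' : (1 : ℝ) ≤ n := by exact_mod_cast hn
  simp only [Finset.card_univ, Fintype.card_prod, Fintype.card_fin, nsmul_eq_mul, Nat.cast_mul]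
  rw [inv_pow, ← div_eq_mul_inv, div_le_div_iff₀ (by positivity) (by positivity)]
  have h3 : (n : ℝ) ^ 3 ≤ (n : ℝ) ^ 4 := pow_le_pow_right₀ hn' (by norm_num)
  have hK : (0 : ℝ) ≤ K := Nat.cast_nonneg _
  nlinarith

/-- With high probability all the small sets have scores of the order of the square root of
their edge boundaries. -/
lemma measureReal_exists_score_le (hn : 0 < n) (hE : ∀ F, MeasurableSet {x | E x = F})
    (hπ : IsPLData P u E π)
    (g : Finset (Fin n) → Finset (Finset (Fin n)) → (e : Finset (Fin n)) → Ranking e → ℝ)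
    {b : ℝ} (hb : 0 < b) (hg : ∀ U F, (∃ x, E x = F) → ∀ e ∈ F, ∀ r, |g U F e r| ≤ b)
    (hmean : ∀ U F, (∃ x, E x = F) → ∀ e ∈ F, ∑ r, plMass u r * g U F e r = 0) :
    P.real {x | ∃ U : Finset (Fin n), U.Nonempty ∧ 2 * U.card ≤ n ∧
      x ∈ {x | b * Real.sqrt (8 * ((edgeCut (E x) U).card * (U.card * Real.log n))) <
        |∑ e ∈ edgeCut (E x) U, g U (E x) e (π x e)|}} ≤ 2 * (3 / (n : ℝ) ^ 2) :=
  measureReal_exists_finset_le hn (fun U _ _ => measureReal_abs_score_gt_le hE hπ U (g U) hb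
    (hg U) (hmean U) (mul_nonneg (Nat.cast_nonneg _)
      (Real.log_nonneg (by exact_mod_cast hn)))) zero_le_two

end UnionBounds

/-! ### Constants, and consistency on regular graphs. -/

section Deterministic

/-- The constant in the lower bound for the edge boundaries. -/
noncomputable def cutConst (M : ℕ) : ℝ := 1 / (2 ^ (M - 1) * (M - 2).factorial) / (2 * M ^ 2)

lemma cutConst_pos {M : ℕ} (hM : 2 ≤ M) : 0 < cutConst M := by
  have : 0 < M := by omega
  unfold cutConst; positivity

/-- The resolution of the level sets of the estimation error. -/
noncomputable def levelGap (M : ℕ) (L ℓ z : ℝ) : ℝ :=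
  2 * ((M : ℝ) ^ 2 * Real.sqrt 8) / (Real.exp (-4 * L) / (3 * (M : ℝ) ^ 2)) * Real.sqrt (ℓ / z)

/-- The constant in the bound for the number of level sets. -/
noncomputable def levelConst (M K : ℕ) : ℝ :=
  8 * ((K : ℝ) * K) ^ 2 * (1 + (8 * (M : ℝ) ^ 2 + 1)) * (M + 2)

/-- The spare factor `2` pays for the halving in the Chernoff bound, so that the observed cut still
exceeds `z * U.card`. -/
lemma meanCut_ge {V : Type*} [Fintype V] [DecidableEq V] {M : ℕ} {p : Finset V → ℝ}
    (hM : 2 ≤ M) (hV : 2 * M ≤ Fintype.card V) {q : ℝ} (hq : 0 ≤ q)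
    (hp : ∀ e, e.card = M → q ≤ p e) {U : Finset V} (hU : 2 * U.card ≤ Fintype.card V) :
    2 * (cutConst M * ((Fintype.card V : ℝ) ^ (M - 1) * q)) * U.card ≤ meanCut M p U := by
  have h1 := cutWeight_ge hM hV hq hp hU
  have h2 := cutWeight_le (fun e he => hq.trans (hp e he)) U
  have hM0 : (0 : ℝ) < M := by exact_mod_cast (by omega : 0 < M)
  have h3 := h1.trans h2
  rw [mul_comm ((M : ℝ) ^ 2), ← div_le_iff₀ (by positivity)] at h3
  refine le_trans (le_of_eq ?_) h3
  unfold cutConst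
  field_simp

lemma log_one_add_mul_card_le {n M : ℕ} (hn : 2 ≤ n) {E : Finset (Finset (Fin n))}
    (hE : ∀ e ∈ E, e.card = M) :
    Real.log (1 + (Fintype.card (Fin n) * E.card : ℕ)) ≤ (M + 2) * Real.log n := by
  have h1 : E.card ≤ n ^ M := by
    calc E.card ≤ (Finset.powersetCard M (Finset.univ : Finset (Fin n))).card :=
          Finset.card_le_card fun e he => by simp [hE e he]
      _ = n.choose M := by simp
      _ ≤ n ^ M := Nat.choose_le_pow _ _
  have h2 : 1 + Fintype.card (Fin n) * E.card ≤ n ^ (M + 2) := by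
    rw [Fintype.card_fin]
    calc 1 + n * E.card ≤ n ^ (M + 1) + n ^ (M + 1) := by
          refine add_le_add (Nat.one_le_pow _ _ (by omega)) ?_
          rw [pow_succ']; exact Nat.mul_le_mul_left _ h1
      _ ≤ n ^ (M + 2) := by
          rw [pow_succ n (M + 1), ← mul_two]; exact Nat.mul_le_mul_left _ hn
  have h3 : (1 + (Fintype.card (Fin n) * E.card : ℕ) : ℝ) ≤ (n : ℝ) ^ (M + 2) := by
    exact_mod_cast h2
  refine (Real.log_le_log (by positivity) h3).trans (le_of_eq ?_)
  rw [Real.log_pow]; push_cast; ring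

variable {n M K : ℕ} {E : Finset (Finset (Fin n))} {u : Fin n → ℝ} {c : Fin n → Fin K}
  {p : Finset (Fin n) → ℝ} {L q : ℝ}

lemma consistency_of_regular (S : ChoiceModel E) (hM : 2 ≤ M) (hn : 2 * M ≤ n)
    (hE : ∀ e ∈ E, e.card = M) (hq : 0 < q) (hpq : ∀ e, e.card = M → q ≤ p e)
    (hp : ∀ (σ : Equiv.Perm (Fin n)), (∀ z, c (σ z) = c z) →
      ∀ e, e.card = M → p (e.map σ.toEmbedding) = p e)
    (hu : ∑ k, u k = 0) (hL : ∀ k, |u k| ≤ L) {z : ℝ}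
    (hz : z = cutConst M * ((n : ℝ) ^ (M - 1) * q)) (hlog : 20 * Real.log n ≤ z)
    (hD : levelGap M L (Real.log n) z ≤ 1)
    (hcut : ∀ U : Finset (Fin n), U.Nonempty → 2 * U.card ≤ n →
      meanCut M p U / 2 ≤ (edgeCut E U).card)
    (hdeg : ∀ v i, (blockDeg E c i v : ℝ) ≤ 2 * meanBlockDeg M p c i v + 4 * Real.log n)
    (hscore : ∀ U : Finset (Fin n), U.Nonempty → 2 * U.card ≤ n →
      |S.score U u| ≤ (M : ℝ) ^ 2 *
        Real.sqrt (8 * ((edgeCut E U).card * (U.card * Real.log n)))) :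
    (∃! v, IsConstrainedMax S.logLik v) ∧ ∀ v, IsConstrainedMax S.logLik v → ∀ k,
      |v k - u k| ≤ 2 * (levelConst M K + 1) * (Real.log n * levelGap M L (Real.log n) z) := by
  have hn4 : (4 : ℝ) ≤ n := by exact_mod_cast (by omega : 4 ≤ n)
  have hℓ : 1 ≤ Real.log n := by
    rw [Real.le_log_iff_exp_le (by linarith)]
    linarith [Real.exp_one_lt_d9]
  have hM1 : (1 : ℝ) ≤ M := by exact_mod_cast (by omega : 1 ≤ M)
  have : Nonempty (Fin n) := ⟨⟨0, by omega⟩⟩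
  have hK : 0 < K := (c ⟨0, by omega⟩).pos
  have hK1 : (1 : ℝ) ≤ K := by exact_mod_cast hK
  have hz0 : 0 < z := by linarith
  have hD0 : 0 ≤ levelGap M L (Real.log n) z := by unfold levelGap; positivity
  have hcard : Fintype.card (Fin n) = n := Fintype.card_fin n
  have hmc : ∀ U : Finset (Fin n), 2 * U.card ≤ n → 2 * z * U.card ≤ meanCut M p U := by
    intro U hU
    have := meanCut_ge hM (by rwa [hcard]) hq.le hpq (U := U) (by rwa [hcard])
    rwa [hcard, ← hz] at this
  have hcut' : ∀ U : Finset (Fin n), U.Nonempty → 2 * U.card ≤ n →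
      z * U.card ≤ (edgeCut E U).card := fun U hU hUs => by
    have := hmc U hUs
    have := hcut U hU hUs
    linarith
  -- `levelConst` is chosen to balance `card_steps_le` when there are `K ^ 2` pairs of blocks and
  -- the volumes have logarithm at most `(M + 2) * log n`.
  set T : ℕ := ⌊levelConst M K * Real.log n⌋₊ + 1 with hT
  have hlc : 0 ≤ levelConst M K := by unfold levelConst; positivity
  have hTlt : levelConst M K * Real.log n < T := by
    rw [hT]; push_cast; exact Nat.lt_floor_add_one _
  have hTle : (T : ℝ) ≤ (levelConst M K + 1) * Real.log n := by
    have := Nat.floor_le (show 0 ≤ levelConst M K * Real.log n by positivity)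
    rw [hT]; push_cast; linarith
  -- The volume constant `8 * M ^ 2 + 1` has two sources: `4 * cutWeight` is at most `4 * M ^ 2`
  -- mean cuts, each at most two observed cuts, and the logarithmic error in the degrees is absorbed
  -- by one more cut.
  have key := S.exists_unique_and_close c (L := L) (m := M) (b := (M : ℝ) ^ 2 * Real.sqrt 8)
    (ℓ := Real.log n) (z := z) hu hL (fun e he => by rw [hE e he]) (by positivity) hM1 hz0
    (by linarith) (D := levelGap M L (Real.log n) z) rfl hD (C := 8 * (M : ℝ) ^ 2 + 1)
    (by positivity) (by rwa [hcard])
    (fun U hU hUs i j => by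
      rw [hcard] at hUs
      have h1 := min_blockVol_le (fun e he => hq.le.trans (hpq e he)) hp
        (show 0 ≤ 4 * Real.log n by linarith) hdeg U i j
      have h2 := cutWeight_le (fun e he => hq.le.trans (hpq e he)) U
      have h3 := hcut U hU hUs
      have h4 := hcut' U hU hUs
      have h5 : (U.card : ℝ) * (4 * Real.log n) ≤ z * U.card := by
        rw [mul_comm z]; gcongr; linarith
      have h6 : (M : ℝ) ^ 2 * meanCut M p U ≤ (M : ℝ) ^ 2 * (2 * (edgeCut E U).card) := by
        gcongr; linarith
      linarith)
    (fun U hU hUs => by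
      rw [hcard] at hUs
      refine (hscore U hU hUs).trans (le_of_eq ?_)
      rw [Real.sqrt_mul (by norm_num), mul_assoc, mul_assoc])
    (T := T) (by
      rw [Fintype.card_prod, Fintype.card_fin]
      have h1 := log_one_add_mul_card_le (by omega) hE
      push_cast at h1 ⊢
      rw [Fintype.card_fin] at h1 ⊢
      have hA : (0 : ℝ) < (K : ℝ) * K := by positivity
      set A : ℝ := (K : ℝ) * K
      set C : ℝ := 1 + (8 * (M : ℝ) ^ 2 + 1) with hC
      have hC0 : 0 < C := by positivity
      calc A * (2 * Real.log (1 + n * E.card)) ≤ A * (2 * ((M + 2) * Real.log n)) := by gcongr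
        _ = (levelConst M K * Real.log n) * (1 / (2 * A * C) / 2) := by
            unfold levelConst
            change _ = 8 * A ^ 2 * C * (M + 2) * Real.log n * (1 / (2 * A * C) / 2)
            field_simp
            ring
        _ < T * (1 / (2 * A * C) / 2) := by gcongr)
  refine ⟨key.1, fun v hv k => (key.2 v hv k).trans ?_⟩
  calc 2 * (T : ℝ) * levelGap M L (Real.log n) z
      ≤ 2 * ((levelConst M K + 1) * Real.log n) * levelGap M L (Real.log n) z := by gcongr
    _ = _ := by ring

end Deterministic

/-! ### Failure probability for a fixed number of vertices. -/

section FixedSize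

variable {Ω : Type*} [MeasurableSpace Ω] {P : Measure Ω} [IsProbabilityMeasure P] {M K n : ℕ}
  {c : Fin n → Fin K} {ω : Fin (K + 1) → ℝ} {E : Ω → Finset (Finset (Fin n))}
  {u : Fin n → ℝ} {π : Ω → (e : Finset (Fin n)) → Ranking e}
  {y : Finset (Finset (Fin n)) → Finset (Fin n) → ℕ} {L z : ℝ}

/-- The factor `20` makes the mean cut at least `40 * U.card * log n`, so the rate `1/10` of the
Chernoff bound leaves the `4 * U.card * log n` needed for the union bound. -/
lemma IsHSBM.measureReal_exists_edgeCut_le (h : IsHSBM P M c ω E) (hM : 2 ≤ M) (hn : 2 * M ≤ n)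
    (hq : 0 < Finset.univ.inf' Finset.univ_nonempty ω)
    (hlog : 20 * Real.log n ≤ cutConst M * zetaMinus M n ω) :
    P.real {x | ∃ U : Finset (Fin n), U.Nonempty ∧ 2 * U.card ≤ n ∧
      x ∈ {x | ((edgeCut (E x) U).card : ℝ) ≤
        meanCut M (fun e => P.real {x | e ∈ E x}) U / 2}} ≤ 1 * (3 / (n : ℝ) ^ 2) := by
  refine measureReal_exists_finset_le (by omega) (fun U _ hUs => ?_) zero_le_one
  refine (h.measureReal_edgeCut_le_le U).trans ?_
  rw [one_mul, Real.exp_le_exp]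
  have h1 := meanCut_ge hM (p := fun e => P.real {x | e ∈ E x}) (by rwa [Fintype.card_fin]) hq.le
    (fun e he => h.inf_le_prob he) (U := U) (by rwa [Fintype.card_fin])
  rw [Fintype.card_fin] at h1
  change 2 * (cutConst M * zetaMinus M n ω) * U.card ≤ _ at h1
  have h2 : 2 * (20 * Real.log n) * U.card ≤ 2 * (cutConst M * zetaMinus M n ω) * U.card := by
    gcongr
  linarith

/-- For every fixed size, both estimators are close to the truth with high probability. -/
lemma measureReal_not_consistent_le (h : IsHSBM P M c ω E) (hπ : IsPLData P u E π)
    (hM : 2 ≤ M) (hn : 2 * M ≤ n) (hq : 0 < Finset.univ.inf' Finset.univ_nonempty ω)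
    (hu : ∑ k, u k = 0) (hL : ∀ k, |u k| ≤ L)
    (hy : ∀ F, (∀ e ∈ F, e.card = M) → ∀ e ∈ F, 1 ≤ y F e ∧ y F e ≤ M)
    (hz : z = cutConst M * zetaMinus M n ω) (hlog : 20 * Real.log n ≤ z)
    (hD : levelGap M L (Real.log n) z ≤ 1) :
    P.real {x | ¬ ((∃! v, IsConstrainedMax (marginalLogLik (E x) (π x) (y (E x))) v) ∧
      (∃! v, IsConstrainedMax (quasiLogLik (E x) (π x)) v) ∧
      ∀ v, (IsConstrainedMax (marginalLogLik (E x) (π x) (y (E x))) v ∨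
        IsConstrainedMax (quasiLogLik (E x) (π x)) v) → ∀ k, |v k - u k| ≤
          2 * (levelConst M K + 1) * (Real.log n * levelGap M L (Real.log n) z))} ≤
      (15 + K) / (n : ℝ) ^ 2 := by
  have hn0 : 0 < n := by omega
  have hcardE : ∀ F, (∃ x, E x = F) → ∀ e ∈ F, e.card = M := by
    rintro F ⟨x, rfl⟩ e he
    exact h.uniform x e he
  have hM0 : (0 : ℝ) < (M : ℝ) ^ 2 := by
    have : (0 : ℝ) < M := by exact_mod_cast (by omega : 0 < M)
    positivity
  have b1 := h.measureReal_exists_edgeCut_le hM hn hq (hz ▸ hlog)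
  have b2 := h.measureReal_exists_blockDeg_le hn0
  have b3 := measureReal_exists_score_le hn0 h.measurableSet_eq hπ
    (fun U F e r => marginalEdgeScore (y F e) U u r) hM0
    (fun U F hF e he r => by
      have := abs_marginalEdgeScore_le (y F e) U u r
      rwa [hcardE F hF e he] at this)
    (fun U F hF e he => sum_plMass_mul_marginalEdgeScore _ U u e)
  have b4 := measureReal_exists_score_le hn0 h.measurableSet_eq hπ
    (fun U F e r => quasiEdgeScore U u r) hM0
    (fun U F hF e he r => by
      have := abs_quasiEdgeScore_le U u r
      rwa [hcardE F hF e he] at this)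
    (fun U F hF e he => sum_plMass_mul_quasiEdgeScore U u e)
  set A1 := {x | ∃ U : Finset (Fin n), U.Nonempty ∧ 2 * U.card ≤ n ∧
      x ∈ {x | ((edgeCut (E x) U).card : ℝ) ≤
        meanCut M (fun e => P.real {x | e ∈ E x}) U / 2}} with hA1
  set A2 := {x | ∃ v i, 2 * meanBlockDeg M (fun e => P.real {x | e ∈ E x}) c i v +
      4 * Real.log n ≤ (blockDeg (E x) c i v : ℝ)} with hA2
  set A3 := {x | ∃ U : Finset (Fin n), U.Nonempty ∧ 2 * U.card ≤ n ∧
      x ∈ {x | (M : ℝ) ^ 2 * Real.sqrt (8 * ((edgeCut (E x) U).card * (U.card * Real.log n))) <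
        |∑ e ∈ edgeCut (E x) U, marginalEdgeScore (y (E x) e) U u (π x e)|}} with hA3
  set A4 := {x | ∃ U : Finset (Fin n), U.Nonempty ∧ 2 * U.card ≤ n ∧
      x ∈ {x | (M : ℝ) ^ 2 * Real.sqrt (8 * ((edgeCut (E x) U).card * (U.card * Real.log n))) <
        |∑ e ∈ edgeCut (E x) U, quasiEdgeScore U u (π x e)|}} with hA4
  -- Failure forces an atypical cut, an atypical degree, or a large score of one of the two models;
  -- the first two events serve both estimators.
  refine (measureReal_mono (s₂ := (A1 ∪ A2) ∪ (A3 ∪ A4)) (fun x hx => ?_)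
    (measure_ne_top _ _)).trans ?_
  · by_contra hgood
    simp only [Set.mem_union, not_or] at hgood
    obtain ⟨⟨g1, g2⟩, g3, g4⟩ := hgood
    have g1' : ∀ U : Finset (Fin n), U.Nonempty → 2 * U.card ≤ n →
        meanCut M (fun e => P.real {x | e ∈ E x}) U / 2 ≤ (edgeCut (E x) U).card := by
      intro U hU hUs
      by_contra hlt
      exact g1 ⟨U, hU, hUs, (not_le.1 hlt).le⟩
    have g2' : ∀ v i, (blockDeg (E x) c i v : ℝ) ≤
        2 * meanBlockDeg M (fun e => P.real {x | e ∈ E x}) c i v + 4 * Real.log n := by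
      intro v i
      by_contra hlt
      exact g2 ⟨v, i, (not_le.1 hlt).le⟩
    have hyE : ∀ e ∈ E x, 1 ≤ y (E x) e := fun e he => (hy (E x) (h.uniform x) e he).1
    have m1 := consistency_of_regular (marginalModel (E x) (π x) (y (E x)) hyE) hM hn
      (h.uniform x) hq (fun e he => h.inf_le_prob he) h.prob_map hu hL hz hlog hD g1' g2'
      (fun U hU hUs => by
        by_contra hlt
        refine g3 ⟨U, hU, hUs, ?_⟩
        rw [ChoiceModel.score_eq_sum_edgeCut] at hlt
        exact not_le.1 hlt)
    have m2 := consistency_of_regular (quasiModel (E x) (π x)) hM hn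
      (h.uniform x) hq (fun e he => h.inf_le_prob he) h.prob_map hu hL hz hlog hD g1' g2'
      (fun U hU hUs => by
        by_contra hlt
        refine g4 ⟨U, hU, hUs, ?_⟩
        rw [ChoiceModel.score_eq_sum_edgeCut] at hlt
        exact not_le.1 hlt)
    rw [logLik_marginalModel] at m1
    rw [logLik_quasiModel] at m2
    exact hx ⟨m1.1, m2.1, fun v hv => hv.elim (m1.2 v) (m2.2 v)⟩
  · refine (measureReal_union_le _ _).trans ((add_le_add (measureReal_union_le _ _)
      (measureReal_union_le _ _)).trans ((add_le_add (add_le_add b1 b2)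
        (add_le_add b3 b4)).trans (le_of_eq ?_)))
    ring

end FixedSize

/-! ### The rate and the almost sure conclusion. -/

section Asymptotic

/-- The constant that relates the resolution of the level sets to the rate. -/
noncomputable def gapConst (M : ℕ) (L : ℝ) : ℝ :=
  2 * ((M : ℝ) ^ 2 * Real.sqrt 8) / (Real.exp (-4 * L) / (3 * (M : ℝ) ^ 2)) /
    Real.sqrt (cutConst M)

lemma gapConst_pos {M : ℕ} (hM : 2 ≤ M) (L : ℝ) : 0 < gapConst M L := by
  have h1 : (0 : ℝ) < M := by exact_mod_cast (by omega : 0 < M)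
  have h2 := Real.sqrt_pos.2 (cutConst_pos hM)
  unfold gapConst; positivity

/-- The number of levels contributes one factor `log n`, which enters the square root as `(log n) ^
2` and produces the cube. -/
lemma log_mul_levelGap {M : ℕ} (hM : 2 ≤ M) (L : ℝ) {n K : ℕ} (hn : 0 < n)
    (ω : Fin (K + 1) → ℝ) :
    Real.log n * levelGap M L (Real.log n) (cutConst M * zetaMinus M n ω) =
      gapConst M L * hsbmRate M n ω := by
  have hℓ : 0 ≤ Real.log n := Real.log_nonneg (by exact_mod_cast hn)
  have hc := Real.sqrt_pos.2 (cutConst_pos hM)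
  have h1 : hsbmRate M n ω =
      Real.log n * (Real.sqrt (cutConst M) *
        Real.sqrt (Real.log n / (cutConst M * zetaMinus M n ω))) := by
    rw [← Real.sqrt_mul (cutConst_pos hM).le]
    conv_rhs => enter [1]; rw [← Real.sqrt_sq hℓ]
    rw [← Real.sqrt_mul (sq_nonneg _), hsbmRate]
    congr 1
    have := (cutConst_pos hM).ne'
    rw [← mul_div_assoc (cutConst M), mul_div_mul_left _ _ this]
    ring
  rw [h1, gapConst, levelGap]
  field_simp

lemma tendsto_hsbmRate {M K : ℕ} {ω : ℕ → Fin (K + 1) → ℝ}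
    (h : Tendsto (fun n : ℕ => Real.log n ^ 3 / zetaMinus M n (ω n)) atTop (𝓝 0)) :
    Tendsto (fun n : ℕ => hsbmRate M n (ω n)) atTop (𝓝 0) := by
  have := (Real.continuous_sqrt.tendsto 0).comp h
  rwa [Real.sqrt_zero] at this

end Asymptotic

theorem mainTheorem4 (M K : ℕ) (hM : 2 ≤ M) (C₁ : ℝ) (hC₁ : 1 ≤ C₁) :
    ∃ C : ℝ, 0 < C ∧
      ∀ {Ω : Type*} [MeasurableSpace Ω] (P : Measure Ω) [IsProbabilityMeasure P]
        -- the utility vectors, block labels, edge probabilities and observed depths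
        (u : (n : ℕ) → Fin n → ℝ)
        (c : (n : ℕ) → Fin n → Fin K)
        (ω : ℕ → Fin (K + 1) → ℝ)
        (y : (n : ℕ) → Finset (Finset (Fin n)) → Finset (Fin n) → ℕ)
        -- the random hypergraphs and the random rankings
        (E : (n : ℕ) → Ω → Finset (Finset (Fin n)))
        (π : (n : ℕ) → Ω → (e : Finset (Fin n)) → Ranking e),
        (∀ n, ∑ k, u n k = 0) →
        (∀ n k, |u n k| ≤ Real.log C₁) →
        (∀ n i, ω n i ∈ Set.Icc (0 : ℝ) 1) →
        (∀ n F, (∀ e ∈ F, e.card = M) → ∀ e ∈ F, 1 ≤ y n F e ∧ y n F e ≤ M) →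
        (∀ n, IsHSBM P M (c n) (ω n) (E n)) →
        (∀ n, IsPLData P (u n) (E n) (π n)) →
        (∀ᶠ n in atTop, 0 < zetaMinus M n (ω n)) →
        Tendsto (fun n : ℕ => Real.log n ^ 3 / zetaMinus M n (ω n)) atTop (𝓝 0) →
        (∀ᵐ x ∂P, ∀ᶠ n in atTop,
          (∃! v, IsConstrainedMax (marginalLogLik (E n x) (π n x) (y n (E n x))) v) ∧
          (∃! v, IsConstrainedMax (quasiLogLik (E n x) (π n x)) v) ∧
          (∀ v, (IsConstrainedMax (marginalLogLik (E n x) (π n x) (y n (E n x))) v ∨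
              IsConstrainedMax (quasiLogLik (E n x) (π n x)) v) →
            ∀ k, |v k - u n k| ≤ C * hsbmRate M n (ω n))) ∧
        Tendsto (fun n : ℕ => hsbmRate M n (ω n)) atTop (𝓝 0) := by
  have hcc := cutConst_pos hM
  have hgc := gapConst_pos hM (Real.log C₁)
  have hlc : 0 ≤ levelConst M K := by unfold levelConst; positivity
  refine ⟨2 * (levelConst M K + 1) * gapConst M (Real.log C₁), by positivity, ?_⟩
  intro Ω _ P _ u c ω y E π hu hL _ hy hE hπ hζ hlim
  have hrate := tendsto_hsbmRate hlim
  refine ⟨?_, hrate⟩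
  have hev : ∀ᶠ n : ℕ in atTop, (2 * M ≤ n ∧ 0 < Finset.univ.inf' Finset.univ_nonempty (ω n)) ∧
      20 * Real.log n ≤ cutConst M * zetaMinus M n (ω n) ∧
      levelGap M (Real.log C₁) (Real.log n) (cutConst M * zetaMinus M n (ω n)) ≤ 1 := by
    filter_upwards [hζ, eventually_ge_atTop (2 * M),
      -- The first limit gives the lower bound on the expected cuts, because `log n ≤ (log n) ^ 3`.
      -- The second bounds `log n` times the level gap by `1`, hence the gap itself.
      hlim.eventually_lt_const (show 0 < cutConst M / 20 by positivity),
      hrate.eventually_lt_const (show 0 < 1 / gapConst M (Real.log C₁) by positivity)]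
      with n hζn hn h1 h2
    have hn4 : (4 : ℝ) ≤ n := by exact_mod_cast (by omega : 4 ≤ n)
    have hℓ : 1 ≤ Real.log n := by
      rw [Real.le_log_iff_exp_le (by linarith)]
      linarith [Real.exp_one_lt_d9]
    refine ⟨⟨hn, ?_⟩, ?_, ?_⟩
    · exact pos_of_mul_pos_right hζn (by positivity)
    · rw [div_lt_iff₀ hζn] at h1
      have : Real.log n ≤ Real.log n ^ 3 := le_self_pow₀ hℓ (by norm_num)
      linarith
    · rw [lt_div_iff₀ hgc, mul_comm,
        ← log_mul_levelGap hM (Real.log C₁) (by omega) (ω n)] at h2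
      have hD0 : 0 ≤ levelGap M (Real.log C₁) (Real.log n)
        (cutConst M * zetaMinus M n (ω n)) := by unfold levelGap; positivity
      nlinarith
  obtain ⟨N, hN⟩ := eventually_atTop.1 hev
  -- The clause `N ≤ n` empties the early events, so that the summable bound holds for all `n`.
  set bad : ℕ → Set Ω := fun n => {x | N ≤ n ∧
    ¬ ((∃! v, IsConstrainedMax (marginalLogLik (E n x) (π n x) (y n (E n x))) v) ∧
      (∃! v, IsConstrainedMax (quasiLogLik (E n x) (π n x)) v) ∧
      ∀ v, (IsConstrainedMax (marginalLogLik (E n x) (π n x) (y n (E n x))) v ∨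
        IsConstrainedMax (quasiLogLik (E n x) (π n x)) v) → ∀ k, |v k - u n k| ≤
          2 * (levelConst M K + 1) * gapConst M (Real.log C₁) * hsbmRate M n (ω n))} with hbad
  have hPbad : ∀ n, P (bad n) ≤ ENNReal.ofReal ((15 + K) * (1 / (n : ℝ) ^ 2)) := by
    intro n
    by_cases hn : N ≤ n
    · obtain ⟨⟨hn2, hq⟩, hlog, hD⟩ := hN n hn
      have := measureReal_not_consistent_le (hE n) (hπ n) hM hn2 hq (hu n) (hL n) (hy n) rfl
        hlog hD
      rw [log_mul_levelGap hM _ (by omega), ← mul_assoc] at this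
      rw [← ofReal_measureReal (measure_ne_top _ _)]
      refine ENNReal.ofReal_le_ofReal ?_
      rw [mul_one_div]
      simpa only [hbad, hn, true_and] using this
    · simp [hbad, hn]
  have hsum : ∑' n, P (bad n) ≠ ⊤ := by
    refine ne_top_of_le_ne_top ?_ (ENNReal.tsum_le_tsum hPbad)
    refine Summable.tsum_ofReal_ne_top ?_
    exact (Real.summable_one_div_nat_pow.2 one_lt_two).mul_left _
  -- The first Borel–Cantelli lemma needs no independence, so the joint law across different `n` is
  -- irrelevant.
  filter_upwards [ae_eventually_notMem hsum] with x hx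
  filter_upwards [hx, eventually_ge_atTop N] with n hxn hn
  by_contra hcon
  exact hxn ⟨hn, hcon⟩
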